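/- **Lemma 3.2 (Subconic Ends).** Let $d\ge 1$, let $N$ be a closed (compact, without boundary) smooth $(d-1)$-dimensional manifold with a smooth Riemannian metric $h$, and let $\theta\in C^\infty([1,\infty);\mathbb R_{>0})$ satisfy $\lim_{r\to\infty}\theta(r)=\infty$ and $\sup_{r\ge1}|\theta^{(m)}(r)|<\infty$ for every $m\ge 1$. The subconic end is $N\times(1,\infty)_r$ with the metric $g_0=dr^2+\theta(r)^2h$. Let $(M,g)$ be a smooth $d$-dimensional Riemannian manifold without boundary which contains the end $N\times(1,\infty)$ as an open subset (through a diffeomorphism onto that subset), such that $c\,g_0\le g\le C\,g_0$ on the end for some constants $c, C>0$ (for instance $g=g_0$ there). Let $a:M\to\mathbb R$, and assume the Network Control Condition: there are $L,\omega,\beta>0$ and a set of points $\{x_m\}\subset M$ such that every $x\in M$ satisfies $d_g(x,\bigcup_m\{x_m\})\le L$, and $\bigcup_m B_g(x_m,\omega)\subset\Omega_{2\beta}$, where $\Omega_{2\beta}=\{x\in M: a(x)>2\beta\}$. Then there exist $R\ge 1$, a finite $n\ge1$, functions $\psi_1,\dots,\psi_n\in C_b^\infty(M_R,\mathbb R)$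 on $M_R=N\times(R,\infty)$, and a constant $\rho>0$, such that $0\le\psi_k\le3$ on $M_R$ for every $k$, and such that for every $k$ and every $x\in M_R\setminus\Omega_{2\beta}$ with $|\nabla_{g_0}\psi_k(x)|<2\rho$ there is an $l$ (depending on $x$) with $$\psi_l(x)\ge1,\qquad |\nabla_{g_0}\psi_l(x)|\ge2\rho,\qquad \psi_l(x)\ge\psi_k(x)+\tfrac12 .$$ Here $\psi\in C_b^\infty(M_R,\mathbb R)$ means that $\psi$ is smooth on $M_R$ and, for each $j\ge0$, $\sup_{M_R}|\nabla^j\psi|_{g_0}<\infty$, where $\nabla^j\psi$ is the $j$-th iterated covariant derivative for the Levi-Civita connection of $g_0$. -/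

import Mathlib

open Set Filter Topology Manifold Bundle
open scoped ContDiff ENNReal

noncomputable section

/-! ### Covariant derivatives of functions on a Riemannian manifold

A (pseudo-)metric tensor is given as a field `G` of bilinear forms on the tangent spaces.  All
coordinate expressions refer to a chart `e` of the manifold and to a basis `b` of the model vector
space, so that `z ↦ (e.extend I).symm z` is the local parametrization and
`(∂_i)_z = d(e.extend I).symm_z (b i)` are the coordinate vector fields. -/

section Covariant

variable {E : Type*} [NormedAddCommGroup E] [NormedSpace ℝ E]
  {H : Type*} [TopologicalSpace H] {I : ModelWithCorners ℝ E H}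
  {M : Type*} [TopologicalSpace M] [ChartedSpace H M]
  {ι : Type*} [Fintype ι] [DecidableEq ι]

/-- The components `g_{ij}` of the metric `G` in the chart `e`. -/
def coordMetric (G : ∀ p : M, TangentSpace I p → TangentSpace I p → ℝ) (b : Module.Basis ι ℝ E)
    (e : OpenPartialHomeomorph M H) (z : E) : Matrix ι ι ℝ :=
  Matrix.of fun i j =>
    G ((e.extend I).symm z)
      (mfderiv 𝓘(ℝ, E) I (e.extend I).symm z (b i))
      (mfderiv 𝓘(ℝ, E) I (e.extend I).symm z (b j))

/-- The partial derivative `∂_i u` of a function `u` of the coordinates. -/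
def coordDeriv (b : Module.Basis ι ℝ E) (i : ι) (u : E → ℝ) (z : E) : ℝ :=
  fderiv ℝ u z (b i)

/-- The Christoffel symbols of the Levi-Civita connection of `G` in the chart `e`:
`Γ^k_{ij} = 1/2 ∑_l g^{kl} (∂_i g_{jl} + ∂_j g_{il} - ∂_l g_{ij})`. -/
def christoffel (G : ∀ p : M, TangentSpace I p → TangentSpace I p → ℝ) (b : Module.Basis ι ℝ E)
    (e : OpenPartialHomeomorph M H) (k i j : ι) (z : E) : ℝ :=
  (1 / 2 : ℝ) * ∑ l, (coordMetric G b e z)⁻¹ k l *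
    (coordDeriv b i (fun w => coordMetric G b e w j l) z
      + coordDeriv b j (fun w => coordMetric G b e w i l) z
      - coordDeriv b l (fun w => coordMetric G b e w i j) z)

/-- The components, in the chart `e`, of the `j`-th iterated covariant derivative `∇^j f` of a
function `f` with respect to the Levi-Civita connection of `G`:
`(∇^{j+1} f)_{α_0 α_1 … α_j} = ∂_{α_0} (∇^j f)_{α_1 … α_j}
  - ∑_s ∑_k Γ^k_{α_0 α_s} (∇^j f)_{α_1 … k … α_j}`, the index `k` being in position `s`. -/
def covDeriv (G : ∀ p : M, TangentSpace I p → TangentSpace I p → ℝ) (b : Module.Basis ι ℝ E)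
    (e : OpenPartialHomeomorph M H) (f : M → ℝ) : (j : ℕ) → (Fin j → ι) → E → ℝ
  | 0, _ => fun z => f ((e.extend I).symm z)
  | j + 1, α => fun z =>
      coordDeriv b (α 0) (covDeriv G b e f j (Fin.tail α)) z
        - ∑ s : Fin j, ∑ k : ι, christoffel G b e k (α 0) (Fin.tail α s) z *
            covDeriv G b e f j (Function.update (Fin.tail α) s k) z

/-- The pointwise norm `|∇^j f|_G` at `p`, computed in a chart `e` around `p`:
`|∇^j f|² = ∑_{α, β} g^{α_1 β_1} ⋯ g^{α_j β_j} (∇^j f)_α (∇^j f)_β`. -/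
def covNorm (G : ∀ p : M, TangentSpace I p → TangentSpace I p → ℝ) (b : Module.Basis ι ℝ E)
    (e : OpenPartialHomeomorph M H) (f : M → ℝ) (j : ℕ) (p : M) : ℝ :=
  Real.sqrt (∑ α : Fin j → ι, ∑ β : Fin j → ι,
    (∏ s, (coordMetric G b e (e.extend I p))⁻¹ (α s) (β s)) *
      covDeriv G b e f j α (e.extend I p) * covDeriv G b e f j β (e.extend I p))

/-- `f` belongs to `C_b^∞(U)` for the metric `G` on the open set `U`: it is smooth on `U`, and for
each `j` the function `|∇^j f|_G` is bounded on `U`.  For smooth `f` the number `|∇^j f|_G (p)` is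
the norm of a tensor: it depends neither on the smooth chart around `p` in which it is computed nor
on the basis `b`, so that "in some chart" and "in every chart" mean the same here. -/
def IsCbInfty (G : ∀ p : M, TangentSpace I p → TangentSpace I p → ℝ) (b : Module.Basis ι ℝ E)
    (U : Set M) (f : M → ℝ) : Prop :=
  ContMDiffOn I 𝓘(ℝ, ℝ) ∞ f U ∧
    ∀ j : ℕ, ∃ C : ℝ, ∀ p ∈ U, ∃ e ∈ IsManifold.maximalAtlas I ∞ M,
      p ∈ e.source ∧ covNorm G b e f j p ≤ C

/-- The length `|∇_G f (p)|` of the gradient of `f`, that is, the norm of the linear form `df_p`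
dual to the norm `√(G_p (v, v))` on the tangent space. -/
def gradNorm (G : ∀ p : M, TangentSpace I p → TangentSpace I p → ℝ) (f : M → ℝ) (p : M) : ℝ :=
  sSup {s : ℝ | ∃ v : TangentSpace I p, G p v v ≤ 1 ∧
    s = (show ℝ from mfderiv I 𝓘(ℝ, ℝ) f p v)}

end Covariant

/-! ### Subconic ends -/

/-- The scaling functions of subconic ends: smooth positive functions on `[1, ∞)` that tend to
infinity and all of whose derivatives of order at least one are bounded. -/
structure IsSubconicScaling (θ : ℝ → ℝ) : Prop where
  smooth : ContDiffOn ℝ ∞ θ (Ici 1)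
  pos : ∀ r, 1 ≤ r → 0 < θ r
  tendsto : Tendsto θ atTop atTop
  bounded : ∀ m : ℕ, 1 ≤ m → ∃ C : ℝ, ∀ r, 1 ≤ r → |iteratedDerivWithin m θ (Ici 1) r| ≤ C

/-- The model with corners of the product `N × ℝ`, where `N` is an `n`-dimensional manifold. -/
abbrev endModel (n : ℕ) : ModelWithCorners ℝ (EuclideanSpace ℝ (Fin n) × ℝ)
    (ModelProd (EuclideanSpace ℝ (Fin n)) ℝ) :=
  (𝓡 n).prod 𝓘(ℝ, ℝ)

/-- The standard basis of `ℝⁿ × ℝ`. -/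
def endBasis (n : ℕ) : Module.Basis (Fin n ⊕ Unit) ℝ (EuclideanSpace ℝ (Fin n) × ℝ) :=
  (EuclideanSpace.basisFun (Fin n) ℝ).toBasis.prod (Module.Basis.singleton Unit ℝ)

/-- The metric `dr² + θ(r)² h` on `N × ℝ`, at the point `p = (y, r)`; here `h` is the Riemannian
metric of `N`. -/
def warpedMetric (n : ℕ) {N : Type*} [TopologicalSpace N]
    [ChartedSpace (EuclideanSpace ℝ (Fin n)) N] [IsManifold (𝓡 n) ∞ N]
    [RiemannianBundle (fun y : N => TangentSpace (𝓡 n) y)] (θ : ℝ → ℝ)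
    (p : N × ℝ) (v w : TangentSpace (endModel n) p) : ℝ :=
  (show ℝ from mfderiv (endModel n) 𝓘(ℝ, ℝ) Prod.snd p v)
      * (show ℝ from mfderiv (endModel n) 𝓘(ℝ, ℝ) Prod.snd p w)
    + θ p.2 ^ 2 * inner ℝ (mfderiv (endModel n) (𝓡 n) Prod.fst p v)
        (mfderiv (endModel n) (𝓡 n) Prod.fst p w)

/-! ### The control condition -/

/-- The control region `Ω_υ = {a > υ}`. -/
def controlRegion {M : Type*} (a : M → ℝ) (υ : ℝ) : Set M := {x | υ < a x}

/-- The Network Control Condition `(L, η, 2β, P)` for the damping `a`: each point is within distance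
`L` of the set `P`, and the balls of radius `η` about the points of `P` lie in `{a > 2β}`. -/
structure NetworkControl {M : Type*} [PseudoEMetricSpace M] (a : M → ℝ) (L η β : ℝ)
    (P : Set M) : Prop where
  L_pos : 0 < L
  η_pos : 0 < η
  β_pos : 0 < β
  dist_le : ∀ x, Metric.infEDist x P ≤ ENNReal.ofReal L
  ball_subset : ∀ p ∈ P, ∀ x, edist x p < ENNReal.ofReal η → x ∈ controlRegion a (2 * β)

end

/-!
In coordinates `(θ(r₀) (x - x₀), r - r₀)` around a far away point `(x₀, r₀)` of the end, the metric
`g₀` and its inverse are bounded together with all their derivatives, uniformly in the point,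
because the derivatives of `θ` are bounded and `θ → ∞`.  Hence a fixed radial bump, transplanted to
such coordinates around each point of a sparse set of points of the network, is a function of class
`C_b^∞`; its value is more than `2` near these points, and where it is at least `1` its gradient is
bounded below except near the points themselves, where one is in the control region.  Cutting the
end into cells of unit size for `g₀` and coloring them periodically splits the network into
finitely many sparse sets.  So at a point outside the control region some bump function is at least
`2` while every function of small gradient is less than `1`.
-/

noncomputable section

section UniformSmoothness

variable {E : Type*} [NormedAddCommGroup E] [NormedSpace ℝ E]
  {F : Type*} [NormedAddCommGroup F] [NormedSpace ℝ F]
  {F' : Type*} [NormedAddCommGroup F'] [NormedSpace ℝ F']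
  {A : Type*} {z : A → E}

/-- A family of maps `u a`, each smooth at the point `z a`, all of whose derivatives at these points
are bounded uniformly in `a`. -/
def UnifSmoothAt (z : A → E) (u : A → E → F) : Prop :=
  (∀ a, ContDiffAt ℝ ∞ (u a) (z a)) ∧
    ∀ k : ℕ, ∃ C : ℝ, ∀ a, ‖iteratedFDeriv ℝ k (u a) (z a)‖ ≤ C

namespace UnifSmoothAt

variable {u v : A → E → F}

theorem congr (hu : UnifSmoothAt z u) (h : ∀ a, v a =ᶠ[𝓝 (z a)] u a) : UnifSmoothAt z v := by
  refine ⟨fun a => (hu.1 a).congr_of_eventuallyEq (h a), fun k => ?_⟩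
  obtain ⟨C, hC⟩ := hu.2 k
  exact ⟨C, fun a => ((h a).iteratedFDeriv ℝ k).eq_of_nhds ▸ hC a⟩

theorem bounded (hu : UnifSmoothAt z u) : ∃ C, ∀ a, ‖u a (z a)‖ ≤ C := by
  obtain ⟨C, hC⟩ := hu.2 0
  exact ⟨C, fun a => by simpa only [norm_iteratedFDeriv_zero] using hC a⟩

theorem exists_uniform_bound (hu : UnifSmoothAt z u) (k : ℕ) :
    ∃ C, 1 ≤ C ∧ ∀ i ≤ k, ∀ a, ‖iteratedFDeriv ℝ i (u a) (z a)‖ ≤ C := by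
  choose C hC using hu.2
  obtain ⟨B, hB⟩ := ((Finset.range (k + 1)).image C).bddAbove
  refine ⟨max 1 B, le_max_left _ _, fun i hi a => (hC i a).trans ((hB ?_).trans (le_max_right _ _))⟩
  exact Finset.mem_coe.2 (Finset.mem_image_of_mem C (Finset.mem_range_succ_iff.2 hi))

theorem clm_comp (hu : UnifSmoothAt z u) (l : F →L[ℝ] F') :
    UnifSmoothAt z fun a w => l (u a w) := by
  refine ⟨fun a => l.contDiff.contDiffAt.comp _ (hu.1 a), fun k => ?_⟩
  obtain ⟨C, hC⟩ := hu.2 k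
  refine ⟨‖l‖ * C, fun a => ?_⟩
  have hle := l.norm_iteratedFDeriv_comp_left (hu.1 a) (n := k) (by exact_mod_cast le_top)
  exact hle.trans (mul_le_mul_of_nonneg_left (hC a) (norm_nonneg _))

theorem add (hu : UnifSmoothAt z u) (hv : UnifSmoothAt z v) :
    UnifSmoothAt z fun a w => u a w + v a w := by
  refine ⟨fun a => (hu.1 a).add (hv.1 a), fun k => ?_⟩
  obtain ⟨C, hC⟩ := hu.2 k
  obtain ⟨D, hD⟩ := hv.2 k
  refine ⟨C + D, fun a => ?_⟩
  have hadd : iteratedFDeriv ℝ k (fun w => u a w + v a w) (z a) =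
      iteratedFDeriv ℝ k (u a) (z a) + iteratedFDeriv ℝ k (v a) (z a) :=
    iteratedFDeriv_add_apply ((hu.1 a).of_le (by exact_mod_cast le_top))
      ((hv.1 a).of_le (by exact_mod_cast le_top))
  exact hadd ▸ (norm_add_le _ _).trans (add_le_add (hC a) (hD a))

theorem prodMk {w : A → E → F'} (hu : UnifSmoothAt z u) (hw : UnifSmoothAt z w) :
    UnifSmoothAt z fun a x => (u a x, w a x) := by
  simpa using (hu.clm_comp (ContinuousLinearMap.inl ℝ F F')).add
    (hw.clm_comp (ContinuousLinearMap.inr ℝ F F'))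

theorem const {c : A → F} (hc : ∃ C, ∀ a, ‖c a‖ ≤ C) : UnifSmoothAt z fun a _ => c a := by
  refine ⟨fun a => contDiffAt_const, fun k => ?_⟩
  rcases k with _ | k
  · simpa only [norm_iteratedFDeriv_zero] using hc
  · exact ⟨0, fun a => by simp [iteratedFDeriv_succ_const]⟩

theorem comp {g : A → F → F'} (hg : UnifSmoothAt (fun a => u a (z a)) g)
    (hu : UnifSmoothAt z u) : UnifSmoothAt z fun a w => g a (u a w) := by
  refine ⟨fun a => (hg.1 a).comp _ (hu.1 a), fun k => ?_⟩
  obtain ⟨C, -, hC⟩ := hg.exists_uniform_bound k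
  obtain ⟨D, hD_one, hD⟩ := hu.exists_uniform_bound k
  refine ⟨k.factorial * C * D ^ k, fun a => ?_⟩
  obtain ⟨s, hs, hzs, hus⟩ :=
    ContDiffWithinAt.contDiffOn' (m := k) (by exact_mod_cast le_top) (by simp) (hu.1 a)
  obtain ⟨t, ht, hut, hgt⟩ :=
    ContDiffWithinAt.contDiffOn' (m := k) (by exact_mod_cast le_top) (by simp) (hg.1 a)
  simp only [insert_eq_of_mem (mem_univ _), univ_inter] at hus hgt
  have hst : IsOpen (s ∩ u a ⁻¹' t) := hus.continuousOn.isOpen_inter_preimage hs ht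
  have hz : z a ∈ s ∩ u a ⁻¹' t := ⟨hzs, hut⟩
  change ‖iteratedFDeriv ℝ k (g a ∘ u a) (z a)‖ ≤ _
  rw [← iteratedFDerivWithin_of_isOpen k hst hz]
  refine norm_iteratedFDerivWithin_comp_le hgt (hus.mono inter_subset_left) le_rfl
    ht.uniqueDiffOn hst.uniqueDiffOn (fun _ hx => hx.2) hz (fun i hi => ?_) (fun i hi_one hi => ?_)
  · rw [iteratedFDerivWithin_of_isOpen i ht hut]
    exact hC i hi a
  · rw [iteratedFDerivWithin_of_isOpen i hst hz]
    exact (hD i hi a).trans (le_self_pow₀ hD_one (by omega))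

theorem of_isCompact {g : E → F} {U K : Set E} (hU : IsOpen U) (hg : ContDiffOn ℝ ∞ g U)
    (hK : IsCompact K) (hKU : K ⊆ U) (h : ∀ a, z a ∈ K) : UnifSmoothAt z fun _ => g := by
  have hgat : ∀ x ∈ K, ContDiffAt ℝ ∞ g x := fun x hx => hg.contDiffAt (hU.mem_nhds (hKU hx))
  refine ⟨fun a => hgat _ (h a), fun k => ?_⟩
  obtain ⟨C, hC⟩ := hK.exists_bound_of_continuousOn fun x hx =>
    ((hgat x hx).continuousAt_iteratedFDeriv (by exact_mod_cast le_top)).continuousWithinAt (s := K)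
  exact ⟨C, fun a => hC _ (h a)⟩

theorem of_contDiff [ProperSpace E] {g : E → F} (hg : ContDiff ℝ ∞ g)
    (hz : ∃ C, ∀ a, ‖z a‖ ≤ C) : UnifSmoothAt z fun _ => g := by
  obtain ⟨C, hC⟩ := hz
  exact of_isCompact isOpen_univ hg.contDiffOn (isCompact_closedBall (0 : E) C) (subset_univ _)
    fun a => mem_closedBall_zero_iff.2 (hC a)

theorem mul {u v : A → E → ℝ} (hu : UnifSmoothAt z u) (hv : UnifSmoothAt z v) :
    UnifSmoothAt z fun a w => u a w * v a w :=
  comp (g := fun _ p => p.1 * p.2)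
    (of_contDiff (contDiff_fst.mul contDiff_snd) (hu.prodMk hv).bounded) (hu.prodMk hv)

theorem sub (hu : UnifSmoothAt z u) (hv : UnifSmoothAt z v) :
    UnifSmoothAt z fun a w => u a w - v a w := by
  simpa [sub_eq_add_neg] using hu.add (hv.clm_comp (-ContinuousLinearMap.id ℝ F))

theorem sum {κ : Type*} (s : Finset κ) {u : κ → A → E → F} (hu : ∀ k, UnifSmoothAt z (u k)) :
    UnifSmoothAt z fun a w => ∑ k ∈ s, u k a w := by
  classical
  induction s using Finset.induction_on with
  | empty => simpa only [Finset.sum_empty] using const (c := fun _ => 0) ⟨0, by simp⟩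
  | insert k s hk ih => simpa only [Finset.sum_insert hk] using (hu k).add ih

theorem prod {κ : Type*} (s : Finset κ) {u : κ → A → E → ℝ} (hu : ∀ k, UnifSmoothAt z (u k)) :
    UnifSmoothAt z fun a w => ∏ k ∈ s, u k a w := by
  classical
  induction s using Finset.induction_on with
  | empty => simpa only [Finset.prod_empty] using const (c := fun _ => 1) ⟨1, by simp⟩
  | insert k s hk ih => simpa only [Finset.prod_insert hk] using (hu k).mul ih

theorem fderiv_apply (hu : UnifSmoothAt z u) (b : E) :
    UnifSmoothAt z fun a w => fderiv ℝ (u a) w b := by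
  have hfderiv : ∀ a, ContDiffAt ℝ ∞ (fderiv ℝ (u a)) (z a) := fun a =>
    (hu.1 a).fderiv_right (by simp)
  refine ⟨fun a => (hfderiv a).clm_apply contDiffAt_const, fun k => ?_⟩
  obtain ⟨C, hC⟩ := hu.2 (k + 1)
  refine ⟨‖b‖ * C, fun a => ?_⟩
  refine (norm_iteratedFDeriv_clm_apply_const (hfderiv a) (by exact_mod_cast le_top)).trans ?_
  rw [norm_iteratedFDeriv_fderiv]
  exact mul_le_mul_of_nonneg_left (hC a) (norm_nonneg _)

theorem const_smul {c : A → ℝ} (hu : UnifSmoothAt z u) (hc : ∃ C, ∀ a, ‖c a‖ ≤ C) :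
    UnifSmoothAt z fun a w => c a • u a w := by
  refine ⟨fun a => contDiffAt_const.smul (hu.1 a), fun k => ?_⟩
  obtain ⟨C, hC⟩ := hu.2 k
  obtain ⟨D, hD⟩ := hc
  refine ⟨D * C, fun a => ?_⟩
  have hsmul : iteratedFDeriv ℝ k (fun w => c a • u a w) (z a) =
      c a • iteratedFDeriv ℝ k (u a) (z a) :=
    iteratedFDeriv_const_smul_apply ((hu.1 a).of_le (by exact_mod_cast le_top))
  rw [hsmul, norm_smul]
  exact mul_le_mul (hD a) (hC a) (norm_nonneg _) ((norm_nonneg _).trans (hD a))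

end UnifSmoothAt

end UniformSmoothness

section Covariant

variable {E : Type*} [NormedAddCommGroup E] [NormedSpace ℝ E]
  {H : Type*} [TopologicalSpace H] {I : ModelWithCorners ℝ E H}
  {M : Type*} [TopologicalSpace M] [ChartedSpace H M]
  {G : ∀ p : M, TangentSpace I p → TangentSpace I p → ℝ}

theorem le_gradNorm {f : M → ℝ} {p : M} {B : ℝ} {v : TangentSpace I p}
    (hB : ∀ w : TangentSpace I p, G p w w ≤ 1 →
      (show ℝ from mfderiv I 𝓘(ℝ, ℝ) f p w) ≤ B)
    (hv : G p v v ≤ 1) : (show ℝ from mfderiv I 𝓘(ℝ, ℝ) f p v) ≤ gradNorm G f p := by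
  refine le_csSup ⟨B, ?_⟩ ⟨v, hv, rfl⟩
  rintro _ ⟨w, hw, rfl⟩
  exact hB w hw

variable {ι : Type*} [Fintype ι] [DecidableEq ι] {b : Module.Basis ι ℝ E}

section UniformBounds

variable {A : Type*} {z : A → E} {e : A → OpenPartialHomeomorph M H} {f : A → M → ℝ}
  (hG : ∀ i j, UnifSmoothAt z fun a w => coordMetric G b (e a) w i j)
  (hG_inv : ∀ i j, UnifSmoothAt z fun a w => (coordMetric G b (e a) w)⁻¹ i j)

include hG hG_inv

theorem unifSmoothAt_christoffel (k i j : ι) :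
    UnifSmoothAt z fun a => christoffel G b (e a) k i j := by
  unfold christoffel coordDeriv
  refine (UnifSmoothAt.const ⟨_, fun _ => le_rfl⟩).mul
    (UnifSmoothAt.sum _ fun l => (hG_inv k l).mul ?_)
  exact (((hG j l).fderiv_apply _).add ((hG i l).fderiv_apply _)).sub ((hG i j).fderiv_apply _)

variable (hf : UnifSmoothAt z fun a w => f a (((e a).extend I).symm w))
include hf

theorem unifSmoothAt_covDeriv (j : ℕ) (α : Fin j → ι) :
    UnifSmoothAt z fun a => covDeriv G b (e a) (f a) j α := by
  induction j with
  | zero => exact hf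
  | succ j ih =>
    simp only [covDeriv, coordDeriv]
    refine ((ih _).fderiv_apply _).sub (UnifSmoothAt.sum _ fun s => UnifSmoothAt.sum _ fun k => ?_)
    exact (unifSmoothAt_christoffel hG hG_inv _ _ _).mul (ih _)

theorem exists_covNorm_le {p : A → M} (hp : ∀ a, (e a).extend I (p a) = z a) (j : ℕ) :
    ∃ C, ∀ a, covNorm G b (e a) (f a) j (p a) ≤ C := by
  have hsum : UnifSmoothAt z fun a w => ∑ α : Fin j → ι, ∑ β : Fin j → ι,
      (∏ s, (coordMetric G b (e a) w)⁻¹ (α s) (β s)) *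
        covDeriv G b (e a) (f a) j α w * covDeriv G b (e a) (f a) j β w :=
    UnifSmoothAt.sum _ fun α => UnifSmoothAt.sum _ fun β =>
      ((UnifSmoothAt.prod _ fun s => hG_inv (α s) (β s)).mul
        (unifSmoothAt_covDeriv hG hG_inv hf j α)).mul (unifSmoothAt_covDeriv hG hG_inv hf j β)
  obtain ⟨C, hC⟩ := hsum.bounded
  refine ⟨Real.sqrt C, fun a => ?_⟩
  rw [covNorm, hp]
  exact Real.sqrt_le_sqrt ((le_abs_self _).trans (hC a))

end UniformBounds

theorem covDeriv_eventuallyEq_zero {e : OpenPartialHomeomorph M H} {f : M → ℝ} {w : E}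
    (hf : (fun w => f ((e.extend I).symm w)) =ᶠ[𝓝 w] 0) (j : ℕ) (α : Fin j → ι) :
    covDeriv G b e f j α =ᶠ[𝓝 w] 0 := by
  induction j with
  | zero => exact hf
  | succ j ih =>
    have hcontr : ∀ᶠ w' in 𝓝 w, ∀ s : Fin j, ∀ k : ι,
        covDeriv G b e f j (Function.update (Fin.tail α) s k) w' = 0 :=
      eventually_all.2 fun s => eventually_all.2 fun k => ih _
    filter_upwards [(ih (Fin.tail α)).eventuallyEq_nhds, hcontr] with w' htail hcontr
    have hfderiv : fderiv ℝ (covDeriv G b e f j (Fin.tail α)) w' = 0 :=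
      htail.fderiv_eq.trans (fderiv_const_apply (0 : ℝ))
    simp [covDeriv, coordDeriv, hfderiv, hcontr]

theorem covNorm_eq_zero_of_eventuallyEq {e : OpenPartialHomeomorph M H} {f : M → ℝ} {p : M}
    (hp : p ∈ e.source) (hf : f =ᶠ[𝓝 p] 0) (j : ℕ) : covNorm G b e f j p = 0 := by
  have hcoord : (fun w => f ((e.extend I).symm w)) =ᶠ[𝓝 (e.extend I p)] 0 := by
    have htendsto := e.continuousAt_extend_symm (I := I) hp
    rw [ContinuousAt, e.extend_left_inv hp] at htendsto
    exact htendsto.eventually hf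
  have hzero := fun α => (covDeriv_eventuallyEq_zero (G := G) (b := b) hcoord j α).eq_of_nhds
  simp only [covNorm, hzero, Pi.zero_apply, mul_zero, Finset.sum_const_zero, Real.sqrt_zero]

variable {U V : Set M} {f : M → ℝ}

theorem isCbInfty_zero [IsManifold I ∞ M] : IsCbInfty G b U fun _ => 0 :=
  ⟨contMDiffOn_const, fun j => ⟨0, fun p _ => ⟨chartAt H p, IsManifold.chart_mem_maximalAtlas p,
    mem_chart_source H p,
    (covNorm_eq_zero_of_eventuallyEq (mem_chart_source H p) EventuallyEq.rfl j).le⟩⟩⟩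

theorem IsCbInfty.mono (hf : IsCbInfty G b U f) (hVU : V ⊆ U) : IsCbInfty G b V f :=
  ⟨hf.1.mono hVU, fun j => (hf.2 j).imp fun _ hC p hp => hC p (hVU hp)⟩

end Covariant

section BilinearForms

theorem det_toMatrix_ne_zero_of_pos {V ι : Type*} [AddCommGroup V] [Module ℝ V] [Fintype ι]
    [DecidableEq ι] (b : Module.Basis ι ℝ V) {B : LinearMap.BilinForm ℝ V}
    (hB : ∀ w ≠ 0, 0 < B w w) :
    (LinearMap.BilinForm.toMatrix b B).det ≠ 0 := by
  have hzero : ∀ w, B w w = 0 → w = 0 := fun w hw => by_contra fun hne => (hB w hne).ne' hw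
  exact (LinearMap.BilinForm.nondegenerate_iff_det_ne_zero b).1
    ⟨fun w hw => hzero w (hw w), fun w hw => hzero w (hw w)⟩

section Family

variable {X V : Type*} [TopologicalSpace X] [NormedAddCommGroup V] [NormedSpace ℝ V]
  [FiniteDimensional ℝ V] {B : X → LinearMap.BilinForm ℝ V} {s : Set X}
  (hB : ∀ v w, ContinuousOn (fun x => B x v w) s)

include hB

theorem continuousOn_bilinForm_self :
    ContinuousOn (fun q : X × V => B q.1 q.2 q.2) (s ×ˢ univ) := by
  let b := Module.finBasis ℝ V
  have hrepr : ∀ i, Continuous fun w : V => b.repr w i := fun i =>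
    LinearMap.continuous_of_finiteDimensional (b.coord i)
  have hsum : ∀ x w, B x w w = ∑ i, b.repr w i * ∑ j, B x (b i) (b j) * b.repr w j := fun x w => by
    rw [LinearMap.BilinForm.apply_eq_dotProduct_toMatrix_mulVec b]
    simp only [dotProduct, Matrix.mulVec, LinearMap.BilinForm.toMatrix_apply]
  simp only [hsum]
  refine continuousOn_finsetSum _ fun i _ =>
    ((hrepr i).comp continuous_snd).continuousOn.mul (continuousOn_finsetSum _ fun j _ => ?_)
  exact ((hB _ _).comp continuousOn_fst fun q hq => hq.1).mul
    ((hrepr j).comp continuous_snd).continuousOn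

theorem exists_bilinForm_self_bounds (hs : IsCompact s)
    (hpos : ∀ x ∈ s, ∀ w ≠ 0, 0 < B x w w) :
    ∃ κ, 1 ≤ κ ∧ ∀ x ∈ s, ∀ w, ‖w‖ ^ 2 ≤ κ * B x w w ∧ B x w w ≤ κ * ‖w‖ ^ 2 := by
  have hS : IsCompact (s ×ˢ Metric.sphere (0 : V) 1) := hs.prod (isCompact_sphere _ _)
  have hcont := (continuousOn_bilinForm_self hB).mono
    (prod_mono_right (subset_univ (Metric.sphere (0 : V) 1)))
  have hpos_sphere : ∀ q ∈ s ×ˢ Metric.sphere (0 : V) 1, 0 < B q.1 q.2 q.2 := fun q hq =>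
    hpos q.1 hq.1 q.2 (ne_zero_of_mem_unit_sphere ⟨q.2, hq.2⟩)
  obtain ⟨C, hC⟩ := hS.exists_bound_of_continuousOn hcont
  obtain ⟨D, hD⟩ := hS.exists_bound_of_continuousOn
    (hcont.inv₀ fun q hq => (hpos_sphere q hq).ne')
  refine ⟨max 1 (max C D), le_max_left _ _, fun x hx w => ?_⟩
  rcases eq_or_ne w 0 with rfl | hw
  · simp
  obtain ⟨t, u, hu, rfl⟩ : ∃ t : ℝ, ∃ u ∈ Metric.sphere (0 : V) 1, w = t • u :=
    ⟨‖w‖, ‖w‖⁻¹ • w, by simp [norm_smul, hw], by simp [smul_smul, hw]⟩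
  have hCu := hC (x, u) ⟨hx, hu⟩
  have hDu : ‖(B x u u)⁻¹‖ ≤ D := hD (x, u) ⟨hx, hu⟩
  have hBu : 0 < B x u u := hpos_sphere (x, u) ⟨hx, hu⟩
  rw [Real.norm_of_nonneg hBu.le] at hCu
  rw [Real.norm_of_nonneg (inv_nonneg.2 hBu.le), inv_le_iff_one_le_mul₀ hBu] at hDu
  have hlower : 1 ≤ max 1 (max C D) * B x u u := hDu.trans
    (mul_le_mul_of_nonneg_right ((le_max_right _ _).trans (le_max_right _ _)) hBu.le)
  have hupper : B x u u ≤ max 1 (max C D) :=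
    hCu.trans ((le_max_left _ _).trans (le_max_right _ _))
  simp only [map_smul, LinearMap.smul_apply, smul_eq_mul, norm_smul,
    mem_sphere_zero_iff_norm.1 hu, mul_one, Real.norm_eq_abs, sq_abs]
  constructor <;> nlinarith [sq_nonneg t]

end Family

section MatrixFamily

variable {V ι : Type*} [NormedAddCommGroup V] [NormedSpace ℝ V] [Fintype ι] [DecidableEq ι]
  {Q : V → Matrix ι ι ℝ} {s : Set V} {k : ℕ∞ω} (hQ : ∀ i j, ContDiffOn ℝ k (fun q => Q q i j) s)

include hQ

theorem contDiffOn_matrix_det : ContDiffOn ℝ k (fun q => (Q q).det) s := by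
  simp only [Matrix.det_apply']
  exact ContDiffOn.sum fun τ _ => contDiffOn_const.mul (contDiffOn_prod fun i _ => hQ _ _)

theorem contDiffOn_matrix_inv (hdet : ∀ q ∈ s, (Q q).det ≠ 0) (i j : ι) :
    ContDiffOn ℝ k (fun q => (Q q)⁻¹ i j) s := by
  simp only [Matrix.inv_def, Matrix.smul_apply, Ring.inverse_eq_inv', smul_eq_mul,
    Matrix.adjugate_apply]
  refine ((contDiffOn_matrix_det hQ).inv hdet).mul (contDiffOn_matrix_det fun k l => ?_)
  rcases eq_or_ne k j with rfl | hk
  · simpa only [Matrix.updateRow_self] using contDiffOn_const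
  · simpa only [Matrix.updateRow_ne hk] using hQ k l

end MatrixFamily

end BilinearForms

section EndCoordinates

local notation "ℝ^" n:max => EuclideanSpace ℝ (Fin n)

variable {n : ℕ} {N : Type*} [TopologicalSpace N] {φ : OpenPartialHomeomorph N (ℝ^n)}
  {θ : ℝ → ℝ} {c : ℝ^n × ℝ}

/-- The coordinates on `N × ℝ` centered at the point with `φ`-coordinates and radius `c = (v, r)`:
those of `N` are stretched by `θ r`, so that the metric `dr² + θ(r)² h` has unit size in them. -/
def endCoord (φ : OpenPartialHomeomorph N (ℝ^n)) (θ : ℝ → ℝ) (c : ℝ^n × ℝ) (p : N × ℝ) : ℝ^n × ℝ :=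
  (θ c.2 • (φ p.1 - c.1), p.2 - c.2)

/-- The parametrization of `N × ℝ` inverse to `endCoord φ θ c`. -/
def endParam (φ : OpenPartialHomeomorph N (ℝ^n)) (θ : ℝ → ℝ) (c z : ℝ^n × ℝ) : N × ℝ :=
  (φ.symm ((θ c.2)⁻¹ • z.1 + c.1), z.2 + c.2)

theorem endParam_endCoord (hc : θ c.2 ≠ 0) {p : N × ℝ} (hp : p.1 ∈ φ.source) :
    endParam φ θ c (endCoord φ θ c p) = p := by
  simp [endParam, endCoord, smul_smul, hc, hp]

theorem endCoord_endParam (hc : θ c.2 ≠ 0) {z : ℝ^n × ℝ}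
    (hz : (θ c.2)⁻¹ • z.1 + c.1 ∈ φ.target) : endCoord φ θ c (endParam φ θ c z) = z := by
  simp [endParam, endCoord, smul_smul, hc, hz]

/-- `endCoord φ θ c` as a chart of `N × ℝ`. -/
def rescaledChart (φ : OpenPartialHomeomorph N (ℝ^n)) (θ : ℝ → ℝ) (c : ℝ^n × ℝ) (hc : θ c.2 ≠ 0) :
    OpenPartialHomeomorph (N × ℝ) (ModelProd (ℝ^n) ℝ) :=
  (φ.transHomeomorph ((Homeomorph.subRight c.1).trans (Homeomorph.smulOfNeZero (θ c.2) hc))).prod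
    (Homeomorph.subRight c.2).toOpenPartialHomeomorph

variable {hc : θ c.2 ≠ 0}

theorem rescaledChart_source : (rescaledChart φ θ c hc).source = φ.source ×ˢ univ := by
  simp [rescaledChart]

theorem rescaledChart_target :
    (rescaledChart φ θ c hc).target = {z | (θ c.2)⁻¹ • z.1 + c.1 ∈ φ.target} := by
  ext z
  change (_ ∧ _) ↔ _
  simp only [OpenPartialHomeomorph.transHomeomorph]
  simp

theorem rescaledChart_extend_target :
    ((rescaledChart φ θ c hc).extend (endModel n)).target =
      {z | (θ c.2)⁻¹ • z.1 + c.1 ∈ φ.target} := by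
  rw [OpenPartialHomeomorph.extend_target, rescaledChart_target]
  ext z
  simp

theorem isOpen_setOf_endParam_mem_target :
    IsOpen {z : ℝ^n × ℝ | (θ c.2)⁻¹ • z.1 + c.1 ∈ φ.target} :=
  φ.open_target.preimage (f := fun z : ℝ^n × ℝ => (θ c.2)⁻¹ • z.1 + c.1) (by fun_prop)

section Smooth

variable [ChartedSpace (ℝ^n) N] (hφ : φ ∈ IsManifold.maximalAtlas (𝓡 n) ∞ N)

include hφ

theorem contMDiffAt_endCoord {p : N × ℝ} (hp : p.1 ∈ φ.source) :
    ContMDiffAt (endModel n) 𝓘(ℝ, ℝ^n × ℝ) ∞ (endCoord φ θ c) p := by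
  have hfst : ContMDiffAt (endModel n) (𝓡 n) ∞ (fun p : N × ℝ => θ c.2 • (φ p.1 - c.1)) p := by
    have hsmooth : ContDiff ℝ ∞ fun v : ℝ^n => θ c.2 • (v - c.1) := by fun_prop
    exact hsmooth.contMDiff.contMDiffAt.comp p
      (ContMDiffAt.comp p (contMDiffAt_of_mem_maximalAtlas hφ hp) contMDiffAt_fst)
  have hsnd : ContMDiffAt (endModel n) 𝓘(ℝ, ℝ) ∞ (fun p : N × ℝ => p.2 - c.2) p := by
    have hsmooth : ContDiff ℝ ∞ fun r : ℝ => r - c.2 := by fun_prop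
    exact hsmooth.contMDiff.contMDiffAt.comp p contMDiffAt_snd
  exact hfst.prodMk_space hsnd

theorem hasMFDerivAt_endParam {z : ℝ^n × ℝ} (hz : (θ c.2)⁻¹ • z.1 + c.1 ∈ φ.target) :
    HasMFDerivAt 𝓘(ℝ, ℝ^n × ℝ) (endModel n) (endParam φ θ c) z
      (((mfderiv 𝓘(ℝ, ℝ^n) (𝓡 n) φ.symm ((θ c.2)⁻¹ • z.1 + c.1)).comp
        ((θ c.2)⁻¹ • ContinuousLinearMap.fst ℝ (ℝ^n) ℝ)).prod
        (ContinuousLinearMap.snd ℝ (ℝ^n) ℝ)) := by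
  have hφ_symm : MDifferentiableAt 𝓘(ℝ, ℝ^n) (𝓡 n) φ.symm ((θ c.2)⁻¹ • z.1 + c.1) :=
    (contMDiffAt_symm_of_mem_maximalAtlas hφ hz).mdifferentiableAt (by simp)
  have hfst : HasFDerivAt (fun z : ℝ^n × ℝ => (θ c.2)⁻¹ • z.1 + c.1)
      ((θ c.2)⁻¹ • ContinuousLinearMap.fst ℝ (ℝ^n) ℝ) z :=
    (((θ c.2)⁻¹ • ContinuousLinearMap.fst ℝ (ℝ^n) ℝ).hasFDerivAt).add_const c.1
  have hsnd : HasFDerivAt (fun z : ℝ^n × ℝ => z.2 + c.2) (ContinuousLinearMap.snd ℝ (ℝ^n) ℝ) z :=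
    hasFDerivAt_snd.add_const c.2
  exact (hφ_symm.hasMFDerivAt.comp z hfst.hasMFDerivAt).prodMk hsnd.hasMFDerivAt

variable [IsManifold (𝓡 n) ∞ N]

theorem rescaledChart_mem_maximalAtlas :
    rescaledChart φ θ c hc ∈ IsManifold.maximalAtlas (endModel n) ∞ (N × ℝ) := by
  apply IsManifold.mem_maximalAtlas_prod <;>
    apply OpenPartialHomeomorph.mem_maximalAtlas_of_contMDiffOn
  · have hsmooth : ContDiff ℝ ∞ fun v : ℝ^n => θ c.2 • (v - c.1) := by fun_prop
    exact hsmooth.contMDiff.comp_contMDiffOn (contMDiffOn_of_mem_maximalAtlas hφ)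
  · have hsmooth : ContDiff ℝ ∞ fun v : ℝ^n => (θ c.2)⁻¹ • v + c.1 := by fun_prop
    exact (contMDiffOn_symm_of_mem_maximalAtlas hφ).comp hsmooth.contMDiff.contMDiffOn
      fun v hv => by simpa [OpenPartialHomeomorph.transHomeomorph] using hv
  · have hsmooth : ContDiff ℝ ∞ fun r : ℝ => r - c.2 := by fun_prop
    exact hsmooth.contMDiff.contMDiffOn
  · have hsmooth : ContDiff ℝ ∞ fun r : ℝ => r + c.2 := by fun_prop
    exact hsmooth.contMDiff.contMDiffOn

theorem contMDiffAt_endParam (hc : θ c.2 ≠ 0) {z : ℝ^n × ℝ}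
    (hz : (θ c.2)⁻¹ • z.1 + c.1 ∈ φ.target) :
    ContMDiffAt 𝓘(ℝ, ℝ^n × ℝ) (endModel n) ∞ (endParam φ θ c) z := by
  have htarget := rescaledChart_extend_target (φ := φ) (hc := hc)
  refine ContMDiffOn.contMDiffAt ?_ (isOpen_setOf_endParam_mem_target.mem_nhds hz)
  rw [← htarget, OpenPartialHomeomorph.extend_target']
  exact contMDiffOn_extend_symm (rescaledChart_mem_maximalAtlas (hc := hc) hφ)

theorem mfderiv_endParam_mfderiv_endCoord (hc : θ c.2 ≠ 0) {p : N × ℝ} (hp : p.1 ∈ φ.source)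
    (v : TangentSpace (endModel n) p) :
    mfderiv 𝓘(ℝ, ℝ^n × ℝ) (endModel n) (endParam φ θ c) (endCoord φ θ c p)
      (mfderiv (endModel n) 𝓘(ℝ, ℝ^n × ℝ) (endCoord φ θ c) p v) = v := by
  have hz : (θ c.2)⁻¹ • (endCoord φ θ c p).1 + c.1 ∈ φ.target := by
    simpa [endCoord, smul_smul, hc] using φ.map_source hp
  have hid : (endParam φ θ c ∘ endCoord φ θ c) =ᶠ[𝓝 p] id := by
    filter_upwards [(φ.open_source.preimage continuous_fst).mem_nhds hp] with q hq
    exact endParam_endCoord hc hq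
  have hcomp := mfderiv_comp_apply p
    ((contMDiffAt_endParam hφ hc hz).mdifferentiableAt (by simp))
    ((contMDiffAt_endCoord hφ hp).mdifferentiableAt (by simp)) v
  rw [hid.mfderiv_eq, mfderiv_id] at hcomp
  exact hcomp.symm

end Smooth

section Metric

variable [ChartedSpace (ℝ^n) N] [RiemannianBundle (fun y : N => TangentSpace (𝓡 n) y)]

/-- The Riemannian metric of `N` in the chart `φ`. -/
def chartForm (φ : OpenPartialHomeomorph N (ℝ^n)) (v : ℝ^n) : LinearMap.BilinForm ℝ (ℝ^n) :=
  (innerₗ (TangentSpace (𝓡 n) (φ.symm v))).compl₁₂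
    (mfderiv 𝓘(ℝ, ℝ^n) (𝓡 n) φ.symm v).toLinearMap (mfderiv 𝓘(ℝ, ℝ^n) (𝓡 n) φ.symm v).toLinearMap

theorem chartForm_pos (hφ : φ ∈ IsManifold.maximalAtlas (𝓡 n) ∞ N) {v w : ℝ^n}
    (hv : v ∈ φ.target) (hw : w ≠ 0) : 0 < chartForm φ v w w := by
  refine (real_inner_self_pos (F := TangentSpace (𝓡 n) (φ.symm v))).2 fun hzero => hw ?_
  have hsymm : MDifferentiableAt (𝓡 n) (𝓡 n) φ.symm v :=
    (contMDiffAt_symm_of_mem_maximalAtlas hφ hv).mdifferentiableAt (by simp)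
  have hdiff : MDifferentiableAt (𝓡 n) (𝓡 n) φ (φ.symm v) :=
    (contMDiffAt_of_mem_maximalAtlas hφ (φ.map_target hv)).mdifferentiableAt (by simp)
  have hcomp := mfderiv_comp_apply v hdiff hsymm w
  have hid : (φ ∘ φ.symm) =ᶠ[𝓝 v] id := φ.eventually_right_inverse hv
  rw [hid.mfderiv_eq, mfderiv_id] at hcomp
  exact hcomp.trans ((congrArg (mfderiv (𝓡 n) (𝓡 n) φ (φ.symm v)) hzero).trans (map_zero _))

variable [IsManifold (𝓡 n) ∞ N]

theorem warpedMetric_apply (p : N × ℝ) (v w : TangentSpace (endModel n) p) :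
    warpedMetric n θ p v w = v.2 * w.2 +
      θ p.2 ^ 2 * inner ℝ (show TangentSpace (𝓡 n) p.1 from v.1)
        (show TangentSpace (𝓡 n) p.1 from w.1) := by
  simp only [warpedMetric, mfderiv_fst, mfderiv_snd]
  rfl

theorem warpedMetric_self_nonneg (p : N × ℝ) (v : TangentSpace (endModel n) p) :
    0 ≤ warpedMetric n θ p v v := by
  rw [warpedMetric_apply]
  exact add_nonneg (mul_self_nonneg _) (mul_nonneg (sq_nonneg _) real_inner_self_nonneg)

theorem warpedMetric_endParam (hφ : φ ∈ IsManifold.maximalAtlas (𝓡 n) ∞ N) {z : ℝ^n × ℝ}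
    (hz : (θ c.2)⁻¹ • z.1 + c.1 ∈ φ.target) (w w' : ℝ^n × ℝ) :
    warpedMetric n θ (endParam φ θ c z)
      (mfderiv 𝓘(ℝ, ℝ^n × ℝ) (endModel n) (endParam φ θ c) z w)
      (mfderiv 𝓘(ℝ, ℝ^n × ℝ) (endModel n) (endParam φ θ c) z w') =
    w.2 * w'.2 +
      (θ (z.2 + c.2) / θ c.2) ^ 2 * chartForm φ ((θ c.2)⁻¹ • z.1 + c.1) w.1 w'.1 := by
  rw [warpedMetric_apply, (hasMFDerivAt_endParam hφ hz).mfderiv]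
  change w.2 * w'.2 + θ (z.2 + c.2) ^ 2 * chartForm φ ((θ c.2)⁻¹ • z.1 + c.1)
    ((θ c.2)⁻¹ • w.1) ((θ c.2)⁻¹ • w'.1) = _
  simp only [map_smul, LinearMap.smul_apply, smul_eq_mul]
  ring

theorem contDiffOn_chartForm [IsContMDiffRiemannianBundle (𝓡 n) ∞ (ℝ^n)
      (fun y : N => TangentSpace (𝓡 n) y)] (hφ : φ ∈ IsManifold.maximalAtlas (𝓡 n) ∞ N)
    (w w' : ℝ^n) : ContDiffOn ℝ ∞ (fun v => chartForm φ v w w') φ.target := by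
  have hfield (w : ℝ^n) : ContMDiffOn (𝓡 n) ((𝓡 n).prod (𝓡 n)) ∞
      (fun v => (TotalSpace.mk' (ℝ^n) (φ.symm v)
        (mfderiv 𝓘(ℝ, ℝ^n) (𝓡 n) φ.symm v w) : TangentBundle (𝓡 n) N)) φ.target := by
    have hmap := (contMDiffOn_symm_of_mem_maximalAtlas hφ).contMDiffOn_tangentMapWithin
      (m := ∞) (by simp) φ.open_target.uniqueMDiffOn
    have hconst : ContMDiff (𝓡 n) ((𝓡 n).prod (𝓡 n)) ∞
        (fun v : ℝ^n => (⟨v, w⟩ : TangentBundle (𝓡 n) _)) := fun v => by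
      rw [contMDiffAt_totalSpace]
      exact ⟨contMDiffAt_id, by simpa using contMDiffAt_const⟩
    refine (hmap.comp hconst.contMDiffOn fun v hv => hv).congr fun v hv => ?_
    simp only [Function.comp_apply, tangentMapWithin]
    rw [mfderivWithin_of_isOpen φ.open_target hv]
  exact contMDiffOn_iff_contDiffOn.1 ((hfield w).inner_bundle (hfield w'))

end Metric

end EndCoordinates

section BlockMetric

local notation "ℝ^" n:max => EuclideanSpace ℝ (Fin n)

variable {n : ℕ} {N : Type*} [TopologicalSpace N] [ChartedSpace (ℝ^n) N]
  [RiemannianBundle (fun y : N => TangentSpace (𝓡 n) y)] {φ : OpenPartialHomeomorph N (ℝ^n)}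

/-- The bilinear form `dr² + τ² h_v` on `ℝⁿ × ℝ`, where `q = (τ, v)` and `h_v` is the metric of `N`
in the chart `φ` at the point with coordinates `v`. -/
def blockForm (φ : OpenPartialHomeomorph N (ℝ^n)) (q : ℝ × ℝ^n) :
    LinearMap.BilinForm ℝ (ℝ^n × ℝ) :=
  (LinearMap.mul ℝ ℝ).compl₁₂ (LinearMap.snd ℝ (ℝ^n) ℝ) (LinearMap.snd ℝ (ℝ^n) ℝ) +
    q.1 ^ 2 • (chartForm φ q.2).compl₁₂ (LinearMap.fst ℝ (ℝ^n) ℝ) (LinearMap.fst ℝ (ℝ^n) ℝ)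

theorem blockForm_apply (q : ℝ × ℝ^n) (w w' : ℝ^n × ℝ) :
    blockForm φ q w w' = w.2 * w'.2 + q.1 ^ 2 * chartForm φ q.2 w.1 w'.1 :=
  rfl

theorem blockForm_pos (hφ : φ ∈ IsManifold.maximalAtlas (𝓡 n) ∞ N) {q : ℝ × ℝ^n} (hq : q.1 ≠ 0)
    (hqφ : q.2 ∈ φ.target) {w : ℝ^n × ℝ} (hw : w ≠ 0) : 0 < blockForm φ q w w := by
  rw [blockForm_apply]
  by_cases hfst : w.1 = 0
  · have hsnd : w.2 ≠ 0 := fun hsnd => hw (Prod.ext hfst hsnd)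
    simpa [hfst] using mul_self_pos.2 hsnd
  · exact add_pos_of_nonneg_of_pos (mul_self_nonneg _)
      (mul_pos (by positivity) (chartForm_pos hφ hqφ hfst))

theorem coordMetric_rescaledChart [IsManifold (𝓡 n) ∞ N]
    (hφ : φ ∈ IsManifold.maximalAtlas (𝓡 n) ∞ N) {θ : ℝ → ℝ} {c : ℝ^n × ℝ} {hc : θ c.2 ≠ 0}
    {z : ℝ^n × ℝ} (hz : (θ c.2)⁻¹ • z.1 + c.1 ∈ φ.target) :
    coordMetric (warpedMetric n θ) (endBasis n) (rescaledChart φ θ c hc) z =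
      LinearMap.BilinForm.toMatrix (endBasis n)
        (blockForm φ (θ (z.2 + c.2) / θ c.2, (θ c.2)⁻¹ • z.1 + c.1)) := by
  ext i j
  rw [LinearMap.BilinForm.toMatrix_apply]
  exact warpedMetric_endParam hφ hz _ _

variable [IsManifold (𝓡 n) ∞ N]
  [IsContMDiffRiemannianBundle (𝓡 n) ∞ (ℝ^n) (fun y : N => TangentSpace (𝓡 n) y)]

theorem contDiffOn_toMatrix_blockForm (hφ : φ ∈ IsManifold.maximalAtlas (𝓡 n) ∞ N)
    (i j : Fin n ⊕ Unit) :
    ContDiffOn ℝ ∞ (fun q => LinearMap.BilinForm.toMatrix (endBasis n) (blockForm φ q) i j)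
      ({0}ᶜ ×ˢ φ.target) := by
  simp only [LinearMap.BilinForm.toMatrix_apply, blockForm_apply]
  exact contDiffOn_const.add ((contDiff_fst.pow 2).contDiffOn.mul
    ((contDiffOn_chartForm hφ _ _).comp contDiff_snd.contDiffOn fun q hq => hq.2))

theorem contDiffOn_toMatrix_blockForm_inv (hφ : φ ∈ IsManifold.maximalAtlas (𝓡 n) ∞ N)
    (i j : Fin n ⊕ Unit) :
    ContDiffOn ℝ ∞ (fun q => (LinearMap.BilinForm.toMatrix (endBasis n) (blockForm φ q))⁻¹ i j)
      ({0}ᶜ ×ˢ φ.target) :=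
  contDiffOn_matrix_inv (contDiffOn_toMatrix_blockForm hφ)
    (fun _ hq => det_toMatrix_ne_zero_of_pos _ fun _ hw => blockForm_pos hφ hq.1 hq.2 hw) i j

/-- A compact set `K` of coordinates in a smooth chart `φ` of `N` on which the metric of `N` and the
Euclidean one are comparable up to the factor `κ`. -/
structure IsAdaptedChart (φ : OpenPartialHomeomorph N (ℝ^n)) (K : Set (ℝ^n)) (κ : ℝ) : Prop where
  mem_maximalAtlas : φ ∈ IsManifold.maximalAtlas (𝓡 n) ∞ N
  isCompact : IsCompact K
  subset_target : K ⊆ φ.target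
  one_le : 1 ≤ κ
  norm_sq_le : ∀ v ∈ K, ∀ w, ‖w‖ ^ 2 ≤ κ * chartForm φ v w w
  le_norm_sq : ∀ v ∈ K, ∀ w, chartForm φ v w w ≤ κ * ‖w‖ ^ 2

theorem exists_isAdaptedChart (hφ : φ ∈ IsManifold.maximalAtlas (𝓡 n) ∞ N) {K : Set (ℝ^n)}
    (hK : IsCompact K) (hKφ : K ⊆ φ.target) : ∃ κ, IsAdaptedChart φ K κ := by
  obtain ⟨κ, hκ, hbounds⟩ := exists_bilinForm_self_bounds
    (fun w w' => ((contDiffOn_chartForm hφ w w').continuousOn).mono hKφ) hK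
    fun v hv w hw => chartForm_pos hφ (hKφ hv) hw
  exact ⟨κ, hφ, hK, hKφ, hκ, fun v hv w => (hbounds v hv w).1, fun v hv w => (hbounds v hv w).2⟩

end BlockMetric

section Scaling

variable {θ : ℝ → ℝ}

namespace IsSubconicScaling

theorem contDiffAt (hθ : IsSubconicScaling θ) {r : ℝ} (hr : 1 < r) : ContDiffAt ℝ ∞ θ r :=
  hθ.smooth.contDiffAt (Ici_mem_nhds hr)

theorem exists_iteratedDeriv_le (hθ : IsSubconicScaling θ) {m : ℕ} (hm : 1 ≤ m) :
    ∃ C : ℝ, ∀ r, 1 < r → |iteratedDeriv m θ r| ≤ C := by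
  obtain ⟨C, hC⟩ := hθ.bounded m hm
  refine ⟨C, fun r hr => ?_⟩
  rw [← iteratedDerivWithin_eq_iteratedDeriv (uniqueDiffOn_Ici 1)
    ((hθ.contDiffAt hr).of_le (by exact_mod_cast le_top)) (mem_Ici.2 hr.le)]
  exact hC r hr.le

theorem exists_abs_sub_le (hθ : IsSubconicScaling θ) :
    ∃ C, 0 ≤ C ∧ ∀ r s, 1 ≤ r → 1 ≤ s → |θ r - θ s| ≤ C * |r - s| := by
  obtain ⟨C, hC⟩ := hθ.bounded 1 le_rfl
  refine ⟨C, (abs_nonneg _).trans (hC 1 le_rfl), fun r s hr hs => ?_⟩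
  exact (convex_Ici (1 : ℝ)).norm_image_sub_le_of_norm_derivWithin_le
    (hθ.smooth.differentiableOn (by simp))
    (fun x hx => by simpa [iteratedDerivWithin_one] using hC x hx) hs hr

theorem exists_le_two_mul (hθ : IsSubconicScaling θ) (D B : ℝ) :
    ∃ R : ℝ, 1 < R ∧ ∀ r, R ≤ r → B ≤ θ r ∧ ∀ s, R ≤ s → |r - s| ≤ D → θ r ≤ 2 * θ s := by
  obtain ⟨C, hC, hlip⟩ := hθ.exists_abs_sub_le
  obtain ⟨R, hR⟩ := eventually_atTop.1 (hθ.tendsto.eventually_ge_atTop (max B (C * D)))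
  refine ⟨max R 2, lt_max_of_lt_right one_lt_two, fun r hr => ?_⟩
  rw [max_le_iff] at hr
  refine ⟨(le_max_left _ _).trans (hR r hr.1), fun s hs hrs => ?_⟩
  rw [max_le_iff] at hs
  have hdiff : θ r - θ s ≤ C * D := calc
    θ r - θ s ≤ |θ r - θ s| := le_abs_self _
    _ ≤ C * |r - s| := hlip r s (by linarith) (by linarith)
    _ ≤ C * D := mul_le_mul_of_nonneg_left hrs hC
  linarith [(le_max_right _ _).trans (hR s hs.1)]

theorem unifSmoothAt (hθ : IsSubconicScaling θ) {A : Type*} {t r σ : A → ℝ}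
    (ht : ∀ a, 1 < t a + r a) (hσ : ∀ a, 1 ≤ σ a) {D : ℝ} (hD : ∀ a, θ (t a + r a) ≤ D * σ a) :
    UnifSmoothAt t fun a x => θ (x + r a) / σ a := by
  have hcomp (a : A) : ContDiffAt ℝ ∞ (fun x => θ (x + r a)) (t a) :=
    (hθ.contDiffAt (ht a)).comp (t a) (contDiffAt_id.add contDiffAt_const)
  refine ⟨fun a => (hcomp a).div_const _, fun k => ?_⟩
  have hσ_pos (a : A) : 0 < σ a := one_pos.trans_le (hσ a)
  rcases Nat.eq_zero_or_pos k with rfl | hk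
  · refine ⟨D, fun a => ?_⟩
    rw [norm_iteratedFDeriv_zero, Real.norm_eq_abs,
      abs_of_pos (div_pos (hθ.pos _ (ht a).le) (hσ_pos a)), div_le_iff₀ (hσ_pos a)]
    exact hD a
  · obtain ⟨C, hC⟩ := hθ.exists_iteratedDeriv_le hk
    refine ⟨C, fun a => ?_⟩
    have hσ_inv : |(σ a)⁻¹| ≤ 1 := by
      rw [abs_inv, abs_of_pos (hσ_pos a)]
      exact inv_le_one_of_one_le₀ (hσ a)
    rw [norm_iteratedFDeriv_eq_norm_iteratedDeriv]
    simp only [div_eq_inv_mul]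
    rw [iteratedDeriv_const_mul_field, iteratedDeriv_comp_add_const, norm_mul]
    exact (mul_le_mul hσ_inv (hC _ (ht a)) (abs_nonneg _) zero_le_one).trans_eq (one_mul C)

end IsSubconicScaling

end Scaling

section Bump

theorem exists_norm_fderiv_le_of_hasCompactSupport {E F : Type*} [NormedAddCommGroup E]
    [NormedSpace ℝ E] [NormedAddCommGroup F] [NormedSpace ℝ F] {f : E → F} (hf : ContDiff ℝ 1 f)
    (hsupp : HasCompactSupport f) : ∃ C : ℝ, ∀ z, ‖fderiv ℝ f z‖ ≤ C :=
  (hsupp.fderiv (𝕜 := ℝ)).exists_bound_of_continuous (hf.continuous_fderiv one_ne_zero)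

variable {V : Type*} [NormedAddCommGroup V] {T : ℝ} {z : V × ℝ}

/-- The squared Euclidean norm on `V × ℝ`, whose own norm is the maximum norm. -/
def sqNorm (z : V × ℝ) : ℝ :=
  ‖z.1‖ ^ 2 + z.2 ^ 2

theorem sqNorm_nonneg (z : V × ℝ) : 0 ≤ sqNorm z := by
  unfold sqNorm; positivity

theorem sqNorm_zero : sqNorm (0 : V × ℝ) = 0 := by
  simp [sqNorm]

theorem norm_sq_le_sqNorm (z : V × ℝ) : ‖z‖ ^ 2 ≤ sqNorm z := by
  rw [Prod.norm_def]
  unfold sqNorm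
  rcases max_cases ‖z.1‖ ‖z.2‖ with ⟨h, _⟩ | ⟨h, _⟩ <;> rw [h]
  · exact le_add_of_nonneg_right (sq_nonneg _)
  · rw [Real.norm_eq_abs, sq_abs]
    exact le_add_of_nonneg_left (sq_nonneg _)

/-- A smooth radial function on `V × ℝ` with maximum `3` at the origin, positive exactly on the ball
of radius `T`, and without critical points in this ball apart from the origin. -/
def radialBump (T : ℝ) (z : V × ℝ) : ℝ :=
  3 * Real.exp 1 * expNegInvGlue (1 - sqNorm z / T ^ 2)

theorem radialBump_nonneg : 0 ≤ radialBump T z :=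
  mul_nonneg (by positivity) (expNegInvGlue.nonneg _)

theorem radialBump_eq_zero (hT : 0 < T) (hz : T ^ 2 ≤ sqNorm z) : radialBump T z = 0 := by
  have hge : 1 ≤ sqNorm z / T ^ 2 := by rwa [le_div_iff₀ (by positivity), one_mul]
  rw [radialBump, expNegInvGlue.zero_of_nonpos (by linarith), mul_zero]

theorem sqNorm_lt_of_radialBump_pos (hT : 0 < T) (hz : 0 < radialBump T z) : sqNorm z < T ^ 2 := by
  contrapose! hz
  exact (radialBump_eq_zero hT hz).le

theorem radialBump_eq_exp (hT : 0 < T) (hz : sqNorm z < T ^ 2) :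
    radialBump T z = 3 * Real.exp (1 - (1 - sqNorm z / T ^ 2)⁻¹) := by
  have hlt : sqNorm z / T ^ 2 < 1 := by rwa [div_lt_one (by positivity)]
  rw [radialBump, expNegInvGlue, if_neg (by linarith), mul_assoc, ← Real.exp_add,
    ← sub_eq_add_neg]

theorem one_le_inv_one_sub (hT : 0 < T) (hz : sqNorm z < T ^ 2) :
    1 ≤ (1 - sqNorm z / T ^ 2)⁻¹ := by
  have hlt : sqNorm z / T ^ 2 < 1 := by rwa [div_lt_one (by positivity)]
  have hnonneg : 0 ≤ sqNorm z / T ^ 2 := div_nonneg (sqNorm_nonneg z) (by positivity)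
  exact (one_le_inv₀ (by linarith)).2 (by linarith)

theorem radialBump_le (hT : 0 < T) (z : V × ℝ) : radialBump T z ≤ 3 := by
  rcases le_or_gt (T ^ 2) (sqNorm z) with hz | hz
  · rw [radialBump_eq_zero hT hz]; norm_num
  · rw [radialBump_eq_exp hT hz]
    linarith [Real.exp_le_one_iff.2 (sub_nonpos.2 (one_le_inv_one_sub hT hz))]

theorem two_le_radialBump (hT : 0 < T) (hz : sqNorm z ≤ (T / 4) ^ 2) : 2 ≤ radialBump T z := by
  have hsq : 0 < T ^ 2 := by positivity
  have hle : sqNorm z / T ^ 2 ≤ 1 / 16 := by rw [div_le_iff₀ hsq]; linarith [div_pow T 4 2]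
  have hinv : (1 - sqNorm z / T ^ 2)⁻¹ ≤ 16 / 15 := by
    rw [inv_le_comm₀ (by linarith) (by norm_num)]; linarith
  rw [radialBump_eq_exp hT (by nlinarith)]
  linarith [Real.add_one_le_exp (1 - (1 - sqNorm z / T ^ 2)⁻¹)]

theorem hasCompactSupport_radialBump [ProperSpace V] (hT : 0 < T) :
    HasCompactSupport (radialBump T : V × ℝ → ℝ) := by
  refine HasCompactSupport.intro (isCompact_closedBall (0 : V × ℝ) T) fun z hz => ?_
  have hlt : T < ‖z‖ := by simpa using hz
  exact radialBump_eq_zero hT ((pow_le_pow_left₀ hT.le hlt.le 2).trans (norm_sq_le_sqNorm z))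

variable [InnerProductSpace ℝ V]

theorem sqNorm_smul (t : ℝ) (z : V × ℝ) : sqNorm (t • z) = t ^ 2 * sqNorm z := by
  simp only [sqNorm, Prod.smul_fst, Prod.smul_snd, norm_smul, smul_eq_mul, mul_pow,
    Real.norm_eq_abs, sq_abs]
  ring

theorem contDiff_sqNorm : ContDiff ℝ ∞ (sqNorm : V × ℝ → ℝ) :=
  (contDiff_fst.norm_sq ℝ).add (contDiff_snd.pow 2)

theorem fderiv_sqNorm_self (z : V × ℝ) : fderiv ℝ sqNorm z z = 2 * sqNorm z := by
  have hfderiv : HasFDerivAt sqNorm (fderiv ℝ sqNorm z) ((1 : ℝ) • z) := by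
    rw [one_smul]
    exact (contDiff_sqNorm.differentiable (by simp) z).hasFDerivAt
  have hray : HasDerivAt (fun t : ℝ => t • z) z 1 := by
    simpa using (hasDerivAt_id (1 : ℝ)).smul_const z
  have hquad : HasDerivAt (fun t : ℝ => sqNorm (t • z)) (2 * sqNorm z) 1 := by
    simp only [sqNorm_smul]
    simpa using (hasDerivAt_pow 2 (1 : ℝ)).mul_const (sqNorm z)
  exact (hfderiv.comp_hasDerivAt (f := fun t : ℝ => t • z) (1 : ℝ) hray).unique hquad

theorem contDiff_radialBump : ContDiff ℝ ∞ (radialBump T : V × ℝ → ℝ) :=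
  contDiff_const.mul
    (expNegInvGlue.contDiff.comp (contDiff_const.sub (contDiff_sqNorm.div_const _)))

theorem fderiv_radialBump_self (T : ℝ) (z : V × ℝ) :
    fderiv ℝ (radialBump T) z z =
      -(radialBump T z * (1 - sqNorm z / T ^ 2)⁻¹ ^ 2 * (2 * sqNorm z / T ^ 2)) := by
  set x := 1 - sqNorm z / T ^ 2 with hx
  have hglue : HasDerivAt expNegInvGlue (x⁻¹ ^ 2 * expNegInvGlue x) x := by
    simpa using expNegInvGlue.hasDerivAt_polynomial_eval_inv_mul 1 x
  have hsqNorm : HasFDerivAt sqNorm (fderiv ℝ sqNorm z) z :=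
    (contDiff_sqNorm.differentiable (by simp) z).hasFDerivAt
  have harg : HasFDerivAt (fun z : V × ℝ => 1 - sqNorm z / T ^ 2)
      (-((T ^ 2)⁻¹ • fderiv ℝ sqNorm z)) z := by
    simpa only [div_eq_inv_mul] using (hsqNorm.const_mul _).const_sub _
  have hbump : HasFDerivAt (radialBump T : V × ℝ → ℝ) ((3 * Real.exp 1) •
      ((x⁻¹ ^ 2 * expNegInvGlue x) • (-((T ^ 2)⁻¹ • fderiv ℝ sqNorm z)))) z :=
    (hglue.comp_hasFDerivAt z harg).const_mul _
  rw [hbump.fderiv, radialBump, ← hx]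
  simp only [smul_apply, neg_apply, fderiv_sqNorm_self, smul_eq_mul]
  ring

theorem le_neg_fderiv_radialBump_self (hT : 0 < T) (hz : 1 ≤ radialBump T z) :
    2 * sqNorm z / T ^ 2 ≤ -fderiv ℝ (radialBump T) z z := by
  have hinv := one_le_inv_one_sub hT (sqNorm_lt_of_radialBump_pos hT (one_pos.trans_le hz))
  have hnonneg : 0 ≤ 2 * sqNorm z / T ^ 2 := by have := sqNorm_nonneg z; positivity
  rw [fderiv_radialBump_self, neg_neg]
  exact le_mul_of_one_le_left hnonneg (one_le_mul_of_one_le_of_one_le hz (one_le_pow₀ hinv))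

theorem fderiv_radialBump_eq (T : ℝ) (z w : V × ℝ) :
    fderiv ℝ (radialBump T) z w = T⁻¹ * fderiv ℝ (radialBump 1) (T⁻¹ • z) w := by
  have hscale : (radialBump T : V × ℝ → ℝ) = fun z => radialBump 1 (T⁻¹ • z) := by
    ext z
    simp only [radialBump, sqNorm_smul, one_pow, inv_pow, inv_one, one_mul, div_eq_inv_mul]
  rw [hscale, fderiv_comp_smul, smul_apply, smul_eq_mul]

theorem exists_abs_fderiv_radialBump_le [ProperSpace V] :
    ∃ C : ℝ, 0 < C ∧ ∀ T : ℝ, 0 < T → ∀ z w : V × ℝ,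
      |fderiv ℝ (radialBump T) z w| ≤ C / T * √(sqNorm w) := by
  obtain ⟨C, hC⟩ := exists_norm_fderiv_le_of_hasCompactSupport (E := V × ℝ)
    (contDiff_radialBump.of_le (by simp)) (hasCompactSupport_radialBump one_pos)
  refine ⟨max C 1, lt_max_of_lt_right one_pos, fun T hT z w => ?_⟩
  calc |fderiv ℝ (radialBump T) z w|
      = T⁻¹ * |fderiv ℝ (radialBump 1) (T⁻¹ • z) w| := by
        rw [fderiv_radialBump_eq, abs_mul, abs_inv, abs_of_pos hT]
    _ ≤ T⁻¹ * (max C 1 * √(sqNorm w)) := by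
        gcongr
        exact (ContinuousLinearMap.le_opNorm _ w).trans (mul_le_mul
          ((hC _).trans (le_max_left _ _)) (Real.le_sqrt_of_sq_le (norm_sq_le_sqNorm w))
          (norm_nonneg _) (by positivity))
    _ = max C 1 / T * √(sqNorm w) := by ring

end Bump

section GoodCenters

local notation "ℝ^" n:max => EuclideanSpace ℝ (Fin n)

variable {n : ℕ} {θ : ℝ → ℝ} {K K' : Set (ℝ^n)} {T S : ℝ} {c z : ℝ^n × ℝ}

/-- `c = (v, r)` is a good center at scale `T` if the rescaled coordinates of norm less than `2 T`
around it stay in the region over `K` in which the scaling function varies by a factor at most `2`.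
-/
structure IsGoodCenter (θ : ℝ → ℝ) (K : Set (ℝ^n)) (T : ℝ) (c : ℝ^n × ℝ) : Prop where
  one_le : 1 ≤ θ c.2
  mem : ∀ z : ℝ^n × ℝ, sqNorm z < (2 * T) ^ 2 → (θ c.2)⁻¹ • z.1 + c.1 ∈ K
  one_lt : ∀ z : ℝ^n × ℝ, sqNorm z < (2 * T) ^ 2 → 1 < z.2 + c.2
  le_two_mul : ∀ z : ℝ^n × ℝ, sqNorm z < (2 * T) ^ 2 → θ (z.2 + c.2) ≤ 2 * θ c.2
  two_mul_le : ∀ z : ℝ^n × ℝ, sqNorm z < (2 * T) ^ 2 → θ c.2 ≤ 2 * θ (z.2 + c.2)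

namespace IsGoodCenter

theorem mono (hc : IsGoodCenter θ K T c) (hK : K ⊆ K') (hS : 0 ≤ S) (hST : S ≤ T) :
    IsGoodCenter θ K' S c := by
  have hlt : ∀ z : ℝ^n × ℝ, sqNorm z < (2 * S) ^ 2 → sqNorm z < (2 * T) ^ 2 := fun z hz =>
    hz.trans_le (by gcongr)
  exact ⟨hc.one_le, fun z hz => hK (hc.mem z (hlt z hz)), fun z hz => hc.one_lt z (hlt z hz),
    fun z hz => hc.le_two_mul z (hlt z hz), fun z hz => hc.two_mul_le z (hlt z hz)⟩

theorem pos (hc : IsGoodCenter θ K T c) : 0 < θ c.2 :=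
  one_pos.trans_le hc.one_le

theorem ne_zero (hc : IsGoodCenter θ K T c) : θ c.2 ≠ 0 :=
  hc.pos.ne'

theorem div_mem_Icc (hc : IsGoodCenter θ K T c) (hz : sqNorm z < (2 * T) ^ 2) :
    θ (z.2 + c.2) / θ c.2 ∈ Icc (1 / 2 : ℝ) 2 := by
  refine ⟨?_, (div_le_iff₀ hc.pos).2 (hc.le_two_mul z hz)⟩
  rw [le_div_iff₀ hc.pos]
  linarith [hc.two_mul_le z hz]

end IsGoodCenter

theorem exists_isGoodCenter (hθ : IsSubconicScaling θ) (hT : 0 < T) {δ : ℝ} (hδ : 0 < δ) :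
    ∃ R : ℝ, 1 < R ∧ ∀ (c : ℝ^n × ℝ) (K : Set (ℝ^n)), R ≤ c.2 → Metric.closedBall c.1 δ ⊆ K →
      IsGoodCenter θ K T c := by
  obtain ⟨R, hR, hslow⟩ := hθ.exists_le_two_mul (2 * T) (max 1 (2 * T / δ))
  refine ⟨R + 2 * T, by linarith, fun c K hc hK => ?_⟩
  have hlarge := (hslow c.2 (by linarith)).1
  have hone : 1 ≤ θ c.2 := (le_max_left _ _).trans hlarge
  have hTδ : 2 * T ≤ θ c.2 * δ := (div_le_iff₀ hδ).1 ((le_max_right _ _).trans hlarge)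
  have hnorm (z : ℝ^n × ℝ) (hz : sqNorm z < (2 * T) ^ 2) : ‖z‖ ≤ 2 * T :=
    (sq_le_sq₀ (norm_nonneg z) (by positivity)).1 ((norm_sq_le_sqNorm z).trans hz.le)
  have habs (z : ℝ^n × ℝ) (hz : sqNorm z < (2 * T) ^ 2) : |z.2| ≤ 2 * T :=
    (norm_snd_le z).trans (hnorm z hz)
  have hheight (z : ℝ^n × ℝ) (hz : sqNorm z < (2 * T) ^ 2) : R ≤ z.2 + c.2 := by
    linarith [(abs_le.1 (habs z hz)).1]
  refine ⟨hone, fun z hz => hK ?_, fun z hz => hR.trans_le (hheight z hz),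
    fun z hz => (hslow _ (hheight z hz)).2 _ (by linarith) ?_,
    fun z hz => (hslow _ (by linarith)).2 _ (hheight z hz) ?_⟩
  · rw [Metric.mem_closedBall, dist_eq_norm, add_sub_cancel_right, norm_smul, norm_inv,
      Real.norm_of_nonneg (by linarith), inv_mul_le_iff₀ (by linarith)]
    exact ((norm_fst_le z).trans (hnorm z hz)).trans hTδ
  · rw [add_sub_cancel_right]
    exact habs z hz
  · rw [sub_add_cancel_right, abs_neg]
    exact habs z hz

variable {N : Type*} [TopologicalSpace N] {φ : OpenPartialHomeomorph N (ℝ^n)}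

/-- The points whose rescaled coordinates around the center `c` have Euclidean norm less than `T`.
-/
def endBall (φ : OpenPartialHomeomorph N (ℝ^n)) (θ : ℝ → ℝ) (T : ℝ) (c : ℝ^n × ℝ) : Set (N × ℝ) :=
  {p | p.1 ∈ φ.source ∧ sqNorm (endCoord φ θ c p) < T ^ 2}

variable [ChartedSpace (ℝ^n) N] [IsManifold (𝓡 n) ∞ N]

theorem mfderiv_mfderiv_endParam (hφ : φ ∈ IsManifold.maximalAtlas (𝓡 n) ∞ N) (hc : θ c.2 ≠ 0)
    (hz : (θ c.2)⁻¹ • z.1 + c.1 ∈ φ.target) {b : ℝ^n × ℝ → ℝ} (hb : DifferentiableAt ℝ b z)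
    {f : N × ℝ → ℝ} (hf : f =ᶠ[𝓝 (endParam φ θ c z)] b ∘ endCoord φ θ c) (w : ℝ^n × ℝ) :
    mfderiv (endModel n) 𝓘(ℝ, ℝ) f (endParam φ θ c z)
      (mfderiv 𝓘(ℝ, ℝ^n × ℝ) (endModel n) (endParam φ θ c) z w) = fderiv ℝ b z w := by
  have hparam := contMDiffAt_endParam hφ hc hz
  have hcoord : MDifferentiableAt (endModel n) 𝓘(ℝ, ℝ^n × ℝ) (endCoord φ θ c) (endParam φ θ c z) :=
    (contMDiffAt_endCoord hφ (φ.map_target hz)).mdifferentiableAt (by simp)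
  have hfdiff : MDifferentiableAt (endModel n) 𝓘(ℝ, ℝ) f (endParam φ θ c z) := by
    refine MDifferentiableAt.congr_of_eventuallyEq (MDifferentiableAt.comp _ ?_ hcoord) hf
    rw [endCoord_endParam hc hz]
    exact hb.mdifferentiableAt
  have hcomp : f ∘ endParam φ θ c =ᶠ[𝓝 z] b := by
    filter_upwards [isOpen_setOf_endParam_mem_target.mem_nhds hz,
      hparam.continuousAt.eventually hf] with z' hz' hfz'
    rw [Function.comp_apply, hfz', Function.comp_apply, endCoord_endParam hc hz']
  refine (mfderiv_comp_apply z hfdiff (hparam.mdifferentiableAt (by simp)) w).symm.trans ?_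
  rw [hcomp.mfderiv_eq, mfderiv_eq_fderiv]
  rfl

theorem mfderiv_endParam_surjective (hφ : φ ∈ IsManifold.maximalAtlas (𝓡 n) ∞ N) (hc : θ c.2 ≠ 0)
    (hz : (θ c.2)⁻¹ • z.1 + c.1 ∈ φ.target) (v : TangentSpace (endModel n) (endParam φ θ c z)) :
    ∃ w : ℝ^n × ℝ, mfderiv 𝓘(ℝ, ℝ^n × ℝ) (endModel n) (endParam φ θ c) z w = v := by
  have hright := mfderiv_endParam_mfderiv_endCoord hφ hc (φ.map_target hz) v
  rw [endCoord_endParam hc hz] at hright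
  exact ⟨_, hright⟩

section Metric

variable [RiemannianBundle (fun y : N => TangentSpace (𝓡 n) y)] {κ : ℝ}

namespace IsGoodCenter

theorem sqNorm_le_warpedMetric (hc : IsGoodCenter θ K T c) (hφ : IsAdaptedChart φ K κ)
    (hz : sqNorm z < (2 * T) ^ 2) (w : ℝ^n × ℝ) :
    sqNorm w ≤ 4 * κ * warpedMetric n θ (endParam φ θ c z)
      (mfderiv 𝓘(ℝ, ℝ^n × ℝ) (endModel n) (endParam φ θ c) z w)
      (mfderiv 𝓘(ℝ, ℝ^n × ℝ) (endModel n) (endParam φ θ c) z w) := by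
  rw [warpedMetric_endParam hφ.mem_maximalAtlas (hφ.subset_target (hc.mem z hz))]
  have hfst := hφ.norm_sq_le _ (hc.mem z hz) w.1
  have hsnd : w.2 ^ 2 ≤ κ * w.2 ^ 2 := le_mul_of_one_le_left (sq_nonneg _) hφ.one_le
  have hratio : (1 / 2 : ℝ) ^ 2 ≤ (θ (z.2 + c.2) / θ c.2) ^ 2 :=
    pow_le_pow_left₀ (by norm_num) (hc.div_mem_Icc hz).1 2
  have hmul := mul_le_mul_of_nonneg_right hratio ((sq_nonneg _).trans hfst)
  unfold sqNorm
  nlinarith [sq_nonneg w.2]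

theorem warpedMetric_le_sqNorm (hc : IsGoodCenter θ K T c) (hφ : IsAdaptedChart φ K κ)
    (hz : sqNorm z < (2 * T) ^ 2) (w : ℝ^n × ℝ) :
    warpedMetric n θ (endParam φ θ c z)
      (mfderiv 𝓘(ℝ, ℝ^n × ℝ) (endModel n) (endParam φ θ c) z w)
      (mfderiv 𝓘(ℝ, ℝ^n × ℝ) (endModel n) (endParam φ θ c) z w) ≤ 4 * κ * sqNorm w := by
  rw [warpedMetric_endParam hφ.mem_maximalAtlas (hφ.subset_target (hc.mem z hz))]
  have hfst := hφ.le_norm_sq _ (hc.mem z hz) w.1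
  have hsnd : w.2 ^ 2 ≤ κ * w.2 ^ 2 := le_mul_of_one_le_left (sq_nonneg _) hφ.one_le
  have hratio : (θ (z.2 + c.2) / θ c.2) ^ 2 ≤ 2 ^ 2 := by
    obtain ⟨hlow, hup⟩ := hc.div_mem_Icc hz
    exact pow_le_pow_left₀ (by linarith) hup 2
  have hmul := mul_le_mul_of_nonneg_left hfst (sq_nonneg (θ (z.2 + c.2) / θ c.2))
  have hmul' := mul_le_mul_of_nonneg_right hratio
    (mul_nonneg (zero_le_one.trans hφ.one_le) (sq_nonneg ‖w.1‖))
  unfold sqNorm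
  nlinarith [sq_nonneg w.2]

theorem fderiv_le_gradNorm (hc : IsGoodCenter θ K T c) (hφ : IsAdaptedChart φ K κ)
    (hz : sqNorm z < (2 * T) ^ 2) {b : ℝ^n × ℝ → ℝ} (hb : DifferentiableAt ℝ b z) {f : N × ℝ → ℝ}
    (hf : f =ᶠ[𝓝 (endParam φ θ c z)] b ∘ endCoord φ θ c) {w : ℝ^n × ℝ}
    (hw : 4 * κ * sqNorm w ≤ 1) :
    fderiv ℝ b z w ≤ gradNorm (warpedMetric n θ) f (endParam φ θ c z) := by
  have htarget := hφ.subset_target (hc.mem z hz)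
  have hderiv (w : ℝ^n × ℝ) : (show ℝ from mfderiv (endModel n) 𝓘(ℝ, ℝ) f (endParam φ θ c z)
      (mfderiv 𝓘(ℝ, ℝ^n × ℝ) (endModel n) (endParam φ θ c) z w)) = fderiv ℝ b z w :=
    mfderiv_mfderiv_endParam hφ.mem_maximalAtlas hc.ne_zero htarget hb hf w
  refine (hderiv w).ge.trans (_root_.le_gradNorm (B := ‖fderiv ℝ b z‖ * √(4 * κ))
    (fun v hv => ?_) ((hc.warpedMetric_le_sqNorm hφ hz w).trans hw))
  obtain ⟨w, rfl⟩ := mfderiv_endParam_surjective hφ.mem_maximalAtlas hc.ne_zero htarget v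
  refine (hderiv w).le.trans ((le_abs_self _).trans (((fderiv ℝ b z).le_opNorm w).trans ?_))
  gcongr
  refine Real.le_sqrt_of_sq_le ((norm_sq_le_sqNorm w).trans ?_)
  refine (hc.sqNorm_le_warpedMetric hφ hz w).trans (mul_le_of_le_one_right ?_ hv)
  linarith [hφ.one_le]

theorem le_gradNorm (hc : IsGoodCenter θ K T c) (hφ : IsAdaptedChart φ K κ) (hT : 0 < T)
    {ε : ℝ} (hε : 0 < ε) (hfar : ε ^ 2 ≤ sqNorm z) (hbump : 1 ≤ radialBump T z) {f : N × ℝ → ℝ}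
    (hf : f =ᶠ[𝓝 (endParam φ θ c z)] radialBump T ∘ endCoord φ θ c) :
    ε / (T ^ 2 * √κ) ≤ gradNorm (warpedMetric n θ) f (endParam φ θ c z) := by
  have hz : sqNorm z < (2 * T) ^ 2 :=
    (sqNorm_lt_of_radialBump_pos hT (one_pos.trans_le hbump)).trans (by gcongr; linarith)
  have hκ : 0 < κ := one_pos.trans_le hφ.one_le
  have hs : 0 < sqNorm z := (sq_pos_of_pos hε).trans_le hfar
  set w : ℝ^n × ℝ := -(2 * √κ * √(sqNorm z))⁻¹ • z with hw
  have hw_unit : 4 * κ * sqNorm w = 1 := by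
    rw [hw, sqNorm_smul, neg_sq, inv_pow, mul_pow, mul_pow, Real.sq_sqrt hκ.le, Real.sq_sqrt hs.le]
    field_simp
    norm_num
  calc ε / (T ^ 2 * √κ)
      ≤ √(sqNorm z) / (T ^ 2 * √κ) := by gcongr; exact Real.le_sqrt_of_sq_le hfar
    _ = (2 * √κ * √(sqNorm z))⁻¹ * (2 * sqNorm z / T ^ 2) := by
        rw [← Real.sq_sqrt hs.le, Real.sqrt_sq (Real.sqrt_nonneg _)]
        field_simp
    _ ≤ (2 * √κ * √(sqNorm z))⁻¹ * -fderiv ℝ (radialBump T) z z := by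
        gcongr
        exact le_neg_fderiv_radialBump_self hT hbump
    _ = fderiv ℝ (radialBump T) z w := by rw [hw, map_smul, smul_eq_mul]; ring
    _ ≤ gradNorm (warpedMetric n θ) f (endParam φ θ c z) :=
        hc.fderiv_le_gradNorm hφ hz (contDiff_radialBump.differentiable (by simp) z) hf hw_unit.le

end IsGoodCenter

end Metric

end GoodCenters

section UniformBounds

local notation "ℝ^" n:max => EuclideanSpace ℝ (Fin n)

variable {n : ℕ} {N : Type*} [TopologicalSpace N] [ChartedSpace (ℝ^n) N]
  [RiemannianBundle (fun y : N => TangentSpace (𝓡 n) y)]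
  {θ : ℝ → ℝ} {φ : OpenPartialHomeomorph N (ℝ^n)} {K : Set (ℝ^n)} {κ T : ℝ} {A : Type*}
  {c z : A → ℝ^n × ℝ} (hc : ∀ a, IsGoodCenter θ K T (c a)) (hφ : IsAdaptedChart φ K κ)
  (hz : ∀ a, sqNorm (z a) < (2 * T) ^ 2)

/-- The pair `(τ, v)` for which `dr² + θ(r)² h` is given by `blockForm φ (τ, v)` at the rescaled
coordinates `z` around `c`. -/
def blockParam (θ : ℝ → ℝ) (c z : ℝ^n × ℝ) : ℝ × ℝ^n :=
  (θ (z.2 + c.2) / θ c.2, (θ c.2)⁻¹ • z.1 + c.1)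

include hz

theorem exists_norm_le_of_sqNorm_lt : ∃ C, ∀ a, ‖z a‖ ≤ C :=
  ⟨|2 * T|, fun a => abs_norm (z a) ▸
    sq_le_sq.1 ((norm_sq_le_sqNorm (z a)).trans (hz a).le)⟩

include hc hφ

theorem unifSmoothAt_blockParam (hθ : IsSubconicScaling θ) :
    UnifSmoothAt z fun a w => blockParam θ (c a) w := by
  have hbounded := exists_norm_le_of_sqNorm_lt hz
  have hratio : UnifSmoothAt z fun a w => θ (w.2 + (c a).2) / θ (c a).2 :=
    UnifSmoothAt.comp (g := fun a x => θ (x + (c a).2) / θ (c a).2)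
      (hθ.unifSmoothAt (fun a => (hc a).one_lt _ (hz a)) (fun a => (hc a).one_le)
        fun a => (hc a).le_two_mul _ (hz a))
      (UnifSmoothAt.of_contDiff contDiff_snd hbounded)
  have hbase : UnifSmoothAt z fun a w => (θ (c a).2)⁻¹ • w.1 := by
    refine (UnifSmoothAt.of_contDiff contDiff_fst hbounded).const_smul ⟨1, fun a => ?_⟩
    rw [norm_inv, Real.norm_of_nonneg (hc a).pos.le]
    exact inv_le_one_of_one_le₀ (hc a).one_le
  have hcenter : ∃ C, ∀ a, ‖(c a).1‖ ≤ C := by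
    obtain ⟨C, hC⟩ := hφ.isCompact.isBounded.exists_norm_le
    refine ⟨C, fun a => hC _ ?_⟩
    simpa using (hc a).mem 0 (by simpa [sqNorm_zero] using (sqNorm_nonneg _).trans_lt (hz a))
  exact hratio.prodMk (hbase.add (UnifSmoothAt.const hcenter))

theorem unifSmoothAt_comp_blockParam (hθ : IsSubconicScaling θ) {F : Type*}
    [NormedAddCommGroup F] [NormedSpace ℝ F] {g : ℝ × ℝ^n → F}
    (hg : ContDiffOn ℝ ∞ g ({0}ᶜ ×ˢ φ.target)) :
    UnifSmoothAt z fun a w => g (blockParam θ (c a) w) := by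
  refine UnifSmoothAt.comp (g := fun _ => g) (UnifSmoothAt.of_isCompact
    (isOpen_compl_singleton.prod φ.open_target) hg ((isCompact_Icc (a := (1 / 2 : ℝ)) (b := 2)).prod
      hφ.isCompact) (prod_mono (fun x hx => ?_) hφ.subset_target)
    fun a => ⟨(hc a).div_mem_Icc (hz a), (hc a).mem _ (hz a)⟩) (unifSmoothAt_blockParam hc hφ hz hθ)
  exact ne_of_gt (one_half_pos.trans_le hx.1)

theorem exists_covNorm_rescaledChart_le [IsManifold (𝓡 n) ∞ N]
    [IsContMDiffRiemannianBundle (𝓡 n) ∞ (ℝ^n) (fun y : N => TangentSpace (𝓡 n) y)]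
    (hθ : IsSubconicScaling θ) {b : ℝ^n × ℝ → ℝ} (hb : ContDiff ℝ ∞ b) {f : A → N × ℝ → ℝ}
    (hf : ∀ a, f a =ᶠ[𝓝 (endParam φ θ (c a) (z a))] b ∘ endCoord φ θ (c a)) (j : ℕ) :
    ∃ D, ∀ a, covNorm (warpedMetric n θ) (endBasis n) (rescaledChart φ θ (c a) (hc a).ne_zero)
      (f a) j (endParam φ θ (c a) (z a)) ≤ D := by
  have htarget (a : A) := hφ.subset_target ((hc a).mem _ (hz a))
  have hmetric (a : A) : (fun w => coordMetric (warpedMetric n θ) (endBasis n)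
      (rescaledChart φ θ (c a) (hc a).ne_zero) w) =ᶠ[𝓝 (z a)] fun w =>
        LinearMap.BilinForm.toMatrix (endBasis n) (blockForm φ (blockParam θ (c a) w)) := by
    filter_upwards [isOpen_setOf_endParam_mem_target.mem_nhds (htarget a)] with w hw
    exact coordMetric_rescaledChart hφ.mem_maximalAtlas hw
  refine exists_covNorm_le (I := endModel n) (z := z) (p := fun a => endParam φ θ (c a) (z a))
    (e := fun a => rescaledChart φ θ (c a) (hc a).ne_zero) (fun k l => ?_) (fun k l => ?_) ?_
    (fun a => endCoord_endParam (hc a).ne_zero (htarget a)) j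
  · exact (unifSmoothAt_comp_blockParam hc hφ hz hθ
      (contDiffOn_toMatrix_blockForm hφ.mem_maximalAtlas k l)).congr
      fun a => (hmetric a).fun_comp fun G => G k l
  · exact (unifSmoothAt_comp_blockParam hc hφ hz hθ
      (contDiffOn_toMatrix_blockForm_inv hφ.mem_maximalAtlas k l)).congr
      fun a => (hmetric a).fun_comp fun G => G⁻¹ k l
  · refine (UnifSmoothAt.of_contDiff hb (exists_norm_le_of_sqNorm_lt hz)).congr fun a => ?_
    have hparam := contMDiffAt_endParam hφ.mem_maximalAtlas (hc a).ne_zero (htarget a)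
    filter_upwards [isOpen_setOf_endParam_mem_target.mem_nhds (htarget a),
      hparam.continuousAt.eventually (hf a)] with w hw hfw
    refine hfw.trans ?_
    rw [Function.comp_apply, endCoord_endParam (hc a).ne_zero hw]

end UniformBounds

section RiemannianDistance

open MeasureTheory
open scoped NNReal

variable {E : Type*} [NormedAddCommGroup E] [NormedSpace ℝ E]
  {H : Type*} [TopologicalSpace H] {I : ModelWithCorners ℝ E H}

section PseudoEMetric

variable {M : Type*} [PseudoEMetricSpace M] [ChartedSpace H M]
  [RiemannianBundle (fun x : M => TangentSpace I x)] [IsRiemannianManifold I M]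

theorem edist_le_of_norm_mfderiv_le {γ : ℝ → M} (hγ : ContMDiffOn 𝓘(ℝ, ℝ) I 1 γ (Icc 0 1))
    {C : ℝ} (hC : ∀ t ∈ Ioo (0 : ℝ) 1, ‖mfderiv 𝓘(ℝ, ℝ) I γ t (1 : ℝ)‖ ≤ C) :
    edist (γ 0) (γ 1) ≤ ENNReal.ofReal C := by
  rw [IsRiemannianManifold.out (I := I) (γ 0) (γ 1)]
  refine (riemannianEDist_le_pathELength hγ rfl rfl zero_le_one).trans ?_
  rw [pathELength_eq_lintegral_mfderiv_Ioo]
  calc ∫⁻ t in Ioo (0 : ℝ) 1, ‖mfderiv 𝓘(ℝ, ℝ) I γ t 1‖ₑ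
      ≤ ∫⁻ _ in Ioo (0 : ℝ) 1, ENNReal.ofReal C := by
        refine setLIntegral_mono' measurableSet_Ioo fun t ht => ?_
        rw [← ofReal_norm]
        exact ENNReal.ofReal_le_ofReal (hC t ht)
    _ = ENNReal.ofReal C := by simp

theorem edist_le_of_norm_mfderiv_smul_le {V : Type*} [NormedAddCommGroup V] [NormedSpace ℝ V]
    {g : V → M} {z : V} (hg : ∀ t ∈ Icc (0 : ℝ) 1, ContMDiffAt 𝓘(ℝ, V) I 1 g (t • z)) {C : ℝ}
    (hC : ∀ t ∈ Icc (0 : ℝ) 1, ‖mfderiv 𝓘(ℝ, V) I g (t • z) z‖ ≤ C) :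
    edist (g 0) (g z) ≤ ENNReal.ofReal C := by
  have hray (t : ℝ) : HasMFDerivAt 𝓘(ℝ, ℝ) 𝓘(ℝ, V) (fun t : ℝ => t • z) t
      (ContinuousLinearMap.toSpanSingleton ℝ z) :=
    ((hasDerivAt_id t).smul_const z |>.congr_deriv (one_smul ℝ z)).hasFDerivAt.hasMFDerivAt
  have hsmooth : ContMDiff 𝓘(ℝ, ℝ) 𝓘(ℝ, V) 1 fun t : ℝ => t • z :=
    (contDiff_id.smul contDiff_const).contMDiff
  have hlength := edist_le_of_norm_mfderiv_le (I := I) (γ := fun t : ℝ => g (t • z)) (C := C)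
    (fun t ht => ((hg t ht).comp t (hsmooth t)).contMDiffWithinAt) fun t ht => ?_
  · simpa only [zero_smul, one_smul] using hlength
  · have ht' := Ioo_subset_Icc_self ht
    have hcomp := (((hg t ht').mdifferentiableAt one_ne_zero).hasMFDerivAt.comp t (hray t)).mfderiv
    refine le_of_eq_of_le (congrArg norm ?_) (hC t ht')
    refine (DFunLike.congr_fun hcomp (1 : ℝ)).trans ?_
    exact congrArg (mfderiv 𝓘(ℝ, V) I g (t • z)) (one_smul ℝ z)

theorem edist_le_mul_of_abs_mfderiv_le {f : M → ℝ} (hf : ContMDiff I 𝓘(ℝ, ℝ) 1 f) {B : ℝ≥0}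
    (hB : ∀ x (v : TangentSpace I x), |(show ℝ from mfderiv I 𝓘(ℝ, ℝ) f x v)| ≤ B * ‖v‖)
    {x y : M} {D : ℝ≥0∞} (hxy : edist x y < D) : edist (f x) (f y) ≤ B * D := by
  rw [IsRiemannianManifold.out (I := I) x y] at hxy
  obtain ⟨γ, rfl, rfl, hγ, hD⟩ := exists_lt_of_riemannianEDist_lt hxy
  rw [IsRiemannianManifold.out (I := 𝓘(ℝ, ℝ)) (f (γ 0)) (f (γ 1))]
  refine (riemannianEDist_le_pathELength (γ := f ∘ γ) (hf.comp_contMDiffOn hγ) rfl rfl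
    zero_le_one).trans ?_
  rw [pathELength_eq_lintegral_mfderiv_Ioo] at hD ⊢
  refine le_trans ?_ (mul_le_mul_right hD.le (B : ℝ≥0∞))
  rw [← lintegral_const_mul' _ _ ENNReal.coe_ne_top]
  refine setLIntegral_mono' measurableSet_Ioo fun t ht => ?_
  have hγt : MDifferentiableAt 𝓘(ℝ, ℝ) I γ t :=
    (hγ.contMDiffAt (Icc_mem_nhds ht.1 ht.2)).mdifferentiableAt one_ne_zero
  have henorm {a b : ℝ} (hab : |a| ≤ B * b) : ‖a‖ₑ ≤ B * ENNReal.ofReal b := by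
    rw [← ofReal_norm, ← ENNReal.ofReal_coe_nnreal, ← ENNReal.ofReal_mul (by positivity)]
    exact ENNReal.ofReal_le_ofReal hab
  rw [mfderiv_comp_apply t ((hf (γ t)).mdifferentiableAt one_ne_zero) hγt,
    enorm_tangentSpace_vectorSpace, ← ofReal_norm (mfderiv 𝓘(ℝ, ℝ) I γ t 1)]
  exact henorm (hB _ _)

end PseudoEMetric

section PartialDiffeomorph

variable {V : Type*} [NormedAddCommGroup V] [NormedSpace ℝ V] {M : Type*} [TopologicalSpace M]
  [ChartedSpace H M] {Ψ : PartialDiffeomorph 𝓘(ℝ, V) I V M 1} {b : V → ℝ}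

/-- The function `b ∘ Ψ⁻¹` on the image of `Ψ`, extended by zero. -/
def pushforward (Ψ : PartialDiffeomorph 𝓘(ℝ, V) I V M 1) (b : V → ℝ) : M → ℝ :=
  Ψ.target.indicator (b ∘ Ψ.symm)

theorem pushforward_apply {z : V} (hz : z ∈ Ψ.source) : pushforward Ψ b (Ψ z) = b z := by
  rw [pushforward, indicator_of_mem (Ψ.map_source hz)]
  exact congrArg b (Ψ.left_inv hz)

theorem exists_of_pushforward_ne_zero {x : M} (hx : pushforward Ψ b x ≠ 0) :
    ∃ z ∈ Ψ.source, Ψ z = x ∧ pushforward Ψ b x = b z := by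
  have hmem := mem_of_indicator_ne_zero hx
  exact ⟨Ψ.symm x, Ψ.map_target hmem, Ψ.right_inv hmem, indicator_of_mem hmem _⟩

theorem tsupport_pushforward_subset [T2Space M] (hb : HasCompactSupport b)
    (hbΨ : tsupport b ⊆ Ψ.source) : tsupport (pushforward Ψ b) ⊆ Ψ '' tsupport b := by
  refine closure_minimal (fun x hx => ?_)
    (hb.isCompact.image_of_continuousOn (Ψ.contMDiffOn.continuousOn.mono hbΨ)).isClosed
  obtain ⟨z, -, rfl, hz⟩ := exists_of_pushforward_ne_zero hx
  exact mem_image_of_mem _ (subset_tsupport b (Function.mem_support.2 (hz ▸ hx)))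

theorem contMDiff_pushforward [T2Space M] (hb : HasCompactSupport b) (hbΨ : tsupport b ⊆ Ψ.source)
    (hb_smooth : ContDiff ℝ 1 b) : ContMDiff I 𝓘(ℝ, ℝ) 1 (pushforward Ψ b) := by
  refine contMDiff_of_tsupport fun x hx => ?_
  obtain ⟨z, hz, rfl⟩ := tsupport_pushforward_subset hb hbΨ hx
  have htarget := Ψ.open_target.mem_nhds (Ψ.map_source (hbΨ hz))
  refine ContMDiffAt.congr_of_eventuallyEq ?_
    (eventually_of_mem htarget fun y hy => indicator_of_mem hy _)
  exact hb_smooth.contMDiff.contMDiffAt.comp _ (Ψ.symm.contMDiffOn.contMDiffAt htarget)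

theorem mfderiv_partialDiffeomorph_surjective {z : V} (hz : z ∈ Ψ.source)
    (v : TangentSpace I (Ψ z)) : ∃ w : V, mfderiv 𝓘(ℝ, V) I Ψ z w = v := by
  have hsymm := Ψ.symm.mdifferentiableAt one_ne_zero (Ψ.map_source hz)
  have hΨ : MDifferentiableAt 𝓘(ℝ, V) I Ψ (Ψ.symm (Ψ z)) := by
    rw [show Ψ.symm (Ψ z) = z from Ψ.left_inv hz]
    exact Ψ.mdifferentiableAt one_ne_zero hz
  have hid : Ψ ∘ Ψ.symm =ᶠ[𝓝 (Ψ z)] id := by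
    filter_upwards [Ψ.open_target.mem_nhds (Ψ.map_source hz)] with x hx
    exact Ψ.right_inv hx
  have hcomp := mfderiv_comp_apply (Ψ z) hΨ hsymm v
  rw [hid.mfderiv_eq, mfderiv_id, show Ψ.symm (Ψ z) = z from Ψ.left_inv hz] at hcomp
  exact ⟨_, hcomp.symm⟩

variable [RiemannianBundle (fun x : M => TangentSpace I x)] {B : ℝ}

theorem abs_mfderiv_pushforward_le [T2Space M] (hb : HasCompactSupport b)
    (hbΨ : tsupport b ⊆ Ψ.source) (hb_smooth : ContDiff ℝ 1 b) (hB : 0 ≤ B)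
    (hbound : ∀ z ∈ tsupport b, ∀ w, |fderiv ℝ b z w| ≤ B * ‖mfderiv 𝓘(ℝ, V) I Ψ z w‖) (x : M)
    (v : TangentSpace I x) :
    |(show ℝ from mfderiv I 𝓘(ℝ, ℝ) (pushforward Ψ b) x v)| ≤ B * ‖v‖ := by
  have habs {s t C : ℝ} (hst : s = t) (hs : |s| ≤ C) : |t| ≤ C := hst ▸ hs
  by_cases hx : x ∈ tsupport (pushforward Ψ b)
  · obtain ⟨z, hz, rfl⟩ := tsupport_pushforward_subset hb hbΨ hx
    obtain ⟨w, rfl⟩ := mfderiv_partialDiffeomorph_surjective (hbΨ hz) v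
    have hcomp := mfderiv_comp_apply z
      ((contMDiff_pushforward hb hbΨ hb_smooth _).mdifferentiableAt one_ne_zero)
      (Ψ.mdifferentiableAt one_ne_zero (hbΨ hz)) w
    have hpull : pushforward Ψ b ∘ Ψ =ᶠ[𝓝 z] b :=
      eventually_of_mem (Ψ.open_source.mem_nhds (hbΨ hz)) fun y hy => pushforward_apply hy
    rw [hpull.mfderiv_eq, mfderiv_eq_fderiv] at hcomp
    exact habs hcomp (hbound z hz w)
  · have hzero := (notMem_tsupport_iff_eventuallyEq.1 hx).mfderiv_eq (I := I) (I' := 𝓘(ℝ, ℝ))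
    have hval := (DFunLike.congr_fun hzero v).trans (DFunLike.congr_fun mfderiv_const v)
    exact habs hval.symm (abs_zero.trans_le (mul_nonneg hB (norm_nonneg v)))

end PartialDiffeomorph

theorem exists_pos_of_edist_lt {V : Type*} [NormedAddCommGroup V] [NormedSpace ℝ V]
    {M : Type*} [EMetricSpace M] [ChartedSpace H M]
    [RiemannianBundle (fun x : M => TangentSpace I x)] [IsRiemannianManifold I M]
    {Ψ : PartialDiffeomorph 𝓘(ℝ, V) I V M 1} {b : V → ℝ} (hb : HasCompactSupport b)
    (hbΨ : tsupport b ⊆ Ψ.source) (hb_smooth : ContDiff ℝ 1 b) {B D : ℝ} (hB : 0 ≤ B)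
    (hbound : ∀ z ∈ tsupport b, ∀ w, |fderiv ℝ b z w| ≤ B * ‖mfderiv 𝓘(ℝ, V) I Ψ z w‖)
    {z : V} (hz : z ∈ Ψ.source) (hBD : B * D < b z) {x : M}
    (hx : edist (Ψ z) x < ENNReal.ofReal D) : ∃ w ∈ Ψ.source, 0 < b w ∧ Ψ w = x := by
  have hD : 0 < D := ENNReal.ofReal_pos.1 (pos_of_gt hx)
  lift B to ℝ≥0 using hB
  have hlip := edist_le_mul_of_abs_mfderiv_le (contMDiff_pushforward hb hbΨ hb_smooth)
    (abs_mfderiv_pushforward_le hb hbΨ hb_smooth B.2 hbound) hx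
  rw [pushforward_apply hz, edist_dist, ← ENNReal.ofReal_coe_nnreal,
    ← ENNReal.ofReal_mul B.coe_nonneg, ENNReal.ofReal_le_ofReal_iff (by positivity),
    Real.dist_eq] at hlip
  have hpos : 0 < pushforward Ψ b x := by linarith [le_abs_self (b z - pushforward Ψ b x)]
  obtain ⟨w, hw, rfl, hval⟩ := exists_of_pushforward_ne_zero hpos.ne'
  exact ⟨w, hw, hval ▸ hpos, rfl⟩

end RiemannianDistance

section EndDistance

local notation "ℝ^" n:max => EuclideanSpace ℝ (Fin n)

variable {n : ℕ} {N : Type*} [TopologicalSpace N] [ChartedSpace (ℝ^n) N] [IsManifold (𝓡 n) ∞ N]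
  {φ : OpenPartialHomeomorph N (ℝ^n)} {θ : ℝ → ℝ} {c z : ℝ^n × ℝ}
  {E : Type*} [NormedAddCommGroup E] [NormedSpace ℝ E]
  {H : Type*} [TopologicalSpace H] {I : ModelWithCorners ℝ E H}

/-- `endParam φ θ c` as a partial diffeomorphism. -/
def endParamDiffeomorph (hφ : φ ∈ IsManifold.maximalAtlas (𝓡 n) ∞ N) (hc : θ c.2 ≠ 0) :
    PartialDiffeomorph 𝓘(ℝ, ℝ^n × ℝ) (endModel n) (ℝ^n × ℝ) (N × ℝ) 1 where
  toFun := endParam φ θ c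
  invFun := endCoord φ θ c
  source := {z | (θ c.2)⁻¹ • z.1 + c.1 ∈ φ.target}
  target := φ.source ×ˢ univ
  map_source' _ hz := ⟨φ.map_target hz, mem_univ _⟩
  map_target' p hp := by simpa [endCoord, smul_smul, hc] using φ.map_source hp.1
  left_inv' _ hz := endCoord_endParam hc hz
  right_inv' _ hp := endParam_endCoord hc hp.1
  open_source := isOpen_setOf_endParam_mem_target
  open_target := φ.open_source.prod isOpen_univ
  contMDiffOn_toFun _ hz :=
    ((contMDiffAt_endParam hφ hc hz).of_le (by simp)).contMDiffWithinAt
  contMDiffOn_invFun _ hp :=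
    ((contMDiffAt_endCoord hφ hp.1).of_le (by simp)).contMDiffWithinAt

section Comparable

variable [RiemannianBundle (fun y : N => TangentSpace (𝓡 n) y)]
  {M : Type*} [TopologicalSpace M] [ChartedSpace H M]
  [RiemannianBundle (fun x : M => TangentSpace I x)]

/-- `Φ` embeds the end `N × (1, ∞)` in `M`, and the metric `g` of `M` satisfies
`α g₀ ≤ g ≤ α' g₀` there, where `g₀ = dr² + θ(r)² h`. -/
structure IsComparableEnd (θ : ℝ → ℝ) (Φ : PartialDiffeomorph (endModel n) I (N × ℝ) M 1)
    (α α' : ℝ) : Prop where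
  source_eq : Φ.source = univ ×ˢ Ioi 1
  pos : 0 < α
  pos' : 0 < α'
  le_norm_sq : ∀ p ∈ Φ.source, ∀ v : TangentSpace (endModel n) p,
    α * warpedMetric n θ p v v ≤ ‖mfderiv (endModel n) I Φ p v‖ ^ 2
  norm_sq_le : ∀ p ∈ Φ.source, ∀ v : TangentSpace (endModel n) p,
    ‖mfderiv (endModel n) I Φ p v‖ ^ 2 ≤ α' * warpedMetric n θ p v v

variable {Φ : PartialDiffeomorph (endModel n) I (N × ℝ) M 1} {α α' κ T : ℝ} {K : Set (ℝ^n)}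

theorem IsComparableEnd.mem_source (hΦ : IsComparableEnd θ Φ α α') (hc : IsGoodCenter θ K T c)
    (hz : sqNorm z < (2 * T) ^ 2) : endParam φ θ c z ∈ Φ.source := by
  rw [hΦ.source_eq]
  exact ⟨mem_univ _, hc.one_lt z hz⟩

/-- The rescaled coordinates around `c`, seen in `M`. -/
abbrev rescaledEnd (Φ : PartialDiffeomorph (endModel n) I (N × ℝ) M 1)
    (hφ : φ ∈ IsManifold.maximalAtlas (𝓡 n) ∞ N) (hc : θ c.2 ≠ 0) :
    PartialDiffeomorph 𝓘(ℝ, ℝ^n × ℝ) I (ℝ^n × ℝ) M 1 :=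
  (endParamDiffeomorph hφ hc).trans Φ

namespace IsGoodCenter

theorem mem_rescaledEnd_source (hc : IsGoodCenter θ K T c) (hφ : IsAdaptedChart φ K κ)
    (hΦ : IsComparableEnd θ Φ α α') (hz : sqNorm z < (2 * T) ^ 2) :
    z ∈ (rescaledEnd Φ hφ.mem_maximalAtlas hc.ne_zero).source :=
  ⟨hφ.subset_target (hc.mem z hz), hΦ.mem_source hc hz⟩

theorem mfderiv_rescaledEnd (hc : IsGoodCenter θ K T c) (hφ : IsAdaptedChart φ K κ)
    (hΦ : IsComparableEnd θ Φ α α') (hz : sqNorm z < (2 * T) ^ 2) (w : ℝ^n × ℝ) :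
    mfderiv 𝓘(ℝ, ℝ^n × ℝ) I (rescaledEnd Φ hφ.mem_maximalAtlas hc.ne_zero) z w =
      mfderiv (endModel n) I Φ (endParam φ θ c z)
        (mfderiv 𝓘(ℝ, ℝ^n × ℝ) (endModel n) (endParam φ θ c) z w) :=
  mfderiv_comp_apply z (Φ.mdifferentiableAt one_ne_zero (hΦ.mem_source hc hz))
    ((contMDiffAt_endParam hφ.mem_maximalAtlas hc.ne_zero
      (hφ.subset_target (hc.mem z hz))).mdifferentiableAt (by simp)) w

theorem norm_mfderiv_rescaledEnd_le (hc : IsGoodCenter θ K T c) (hφ : IsAdaptedChart φ K κ)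
    (hΦ : IsComparableEnd θ Φ α α') (hz : sqNorm z < (2 * T) ^ 2) (w : ℝ^n × ℝ) :
    ‖mfderiv 𝓘(ℝ, ℝ^n × ℝ) I (rescaledEnd Φ hφ.mem_maximalAtlas hc.ne_zero) z w‖ ≤
      √(α' * (4 * κ * sqNorm w)) := by
  rw [hc.mfderiv_rescaledEnd hφ hΦ hz]
  refine Real.le_sqrt_of_sq_le ((hΦ.norm_sq_le _ (hΦ.mem_source hc hz) _).trans ?_)
  exact mul_le_mul_of_nonneg_left (hc.warpedMetric_le_sqNorm hφ hz w) hΦ.pos'.le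

theorem sqrt_sqNorm_le (hc : IsGoodCenter θ K T c) (hφ : IsAdaptedChart φ K κ)
    (hΦ : IsComparableEnd θ Φ α α') (hz : sqNorm z < (2 * T) ^ 2) (w : ℝ^n × ℝ) :
    √(sqNorm w) ≤ √(4 * κ / α) *
      ‖mfderiv 𝓘(ℝ, ℝ^n × ℝ) I (rescaledEnd Φ hφ.mem_maximalAtlas hc.ne_zero) z w‖ := by
  have hκ : 0 < κ := one_pos.trans_le hφ.one_le
  have hsqrt {s G m : ℝ} (hm : 0 ≤ m) (hs : s ≤ 4 * κ * G) (hG : α * G ≤ m ^ 2) :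
      √s ≤ √(4 * κ / α) * m := by
    rw [Real.sqrt_le_left (by positivity), mul_pow,
      Real.sq_sqrt (div_nonneg (by positivity) hΦ.pos.le), div_mul_eq_mul_div, le_div_iff₀ hΦ.pos]
    nlinarith [hΦ.pos]
  rw [hc.mfderiv_rescaledEnd hφ hΦ hz]
  exact hsqrt (norm_nonneg _) (hc.sqNorm_le_warpedMetric hφ hz w)
    (hΦ.le_norm_sq _ (hΦ.mem_source hc hz) _)

end IsGoodCenter

end Comparable

section Distance

variable [RiemannianBundle (fun y : N => TangentSpace (𝓡 n) y)]
  {M : Type*} [EMetricSpace M] [ChartedSpace H M]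
  [RiemannianBundle (fun x : M => TangentSpace I x)] [IsRiemannianManifold I M]
  {Φ : PartialDiffeomorph (endModel n) I (N × ℝ) M 1} {α α' κ T : ℝ} {K : Set (ℝ^n)}

namespace IsGoodCenter

theorem edist_le (hc : IsGoodCenter θ K T c) (hφ : IsAdaptedChart φ K κ)
    (hΦ : IsComparableEnd θ Φ α α') (hz : sqNorm z < (2 * T) ^ 2) :
    edist (Φ (endParam φ θ c 0)) (Φ (endParam φ θ c z)) ≤
      ENNReal.ofReal √(α' * (4 * κ * sqNorm z)) := by
  have hray (t : ℝ) (ht : t ∈ Icc (0 : ℝ) 1) : sqNorm (t • z) < (2 * T) ^ 2 := by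
    rw [sqNorm_smul]
    exact (mul_le_of_le_one_left (sqNorm_nonneg z) (pow_le_one₀ ht.1 ht.2)).trans_lt hz
  let Ψ := rescaledEnd Φ hφ.mem_maximalAtlas hc.ne_zero
  exact edist_le_of_norm_mfderiv_smul_le (I := I) (g := Ψ)
    (fun t ht => Ψ.contMDiffOn.contMDiffAt
      (Ψ.open_source.mem_nhds (hc.mem_rescaledEnd_source hφ hΦ (hray t ht))))
    fun t ht => hc.norm_mfderiv_rescaledEnd_le hφ hΦ (hray t ht) z

-- The bump around `c` is a function on `M` with small gradient that is at least `2` at the center,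
-- so that it stays positive on the ball of radius `D`.
theorem exists_eq_endParam_of_edist_lt (hc : IsGoodCenter θ K T c) (hφ : IsAdaptedChart φ K κ)
    (hΦ : IsComparableEnd θ Φ α α') (hT : 0 < T) {B : ℝ} (hB : 0 ≤ B)
    (hbump : ∀ z w : ℝ^n × ℝ, |fderiv ℝ (radialBump T) z w| ≤ B / T * √(sqNorm w)) {D : ℝ}
    (hD : B / T * √(4 * κ / α) * D < 2) {x : M}
    (hx : edist (Φ (endParam φ θ c 0)) x < ENNReal.ofReal D) :
    ∃ z, sqNorm z < T ^ 2 ∧ x = Φ (endParam φ θ c z) := by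
  have hlt (z : ℝ^n × ℝ) (hz : sqNorm z ≤ T ^ 2) : sqNorm z < (2 * T) ^ 2 :=
    hz.trans_lt (by gcongr; linarith)
  have hsupport : tsupport (radialBump T) ⊆ {z : ℝ^n × ℝ | sqNorm z ≤ T ^ 2} := by
    refine closure_minimal (fun z hz => ?_) (isClosed_le contDiff_sqNorm.continuous
      continuous_const)
    exact (sqNorm_lt_of_radialBump_pos hT (radialBump_nonneg.lt_of_ne' hz)).le
  have hzero : 2 ≤ radialBump T (0 : ℝ^n × ℝ) :=
    two_le_radialBump hT (by rw [sqNorm_zero]; positivity)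
  let Ψ := rescaledEnd Φ hφ.mem_maximalAtlas hc.ne_zero
  have hbound : ∀ z ∈ tsupport (radialBump T), ∀ w : ℝ^n × ℝ,
      |fderiv ℝ (radialBump T) z w| ≤ B / T * √(4 * κ / α) * ‖mfderiv 𝓘(ℝ, ℝ^n × ℝ) I Ψ z w‖ := by
    intro z hz w
    refine (hbump z w).trans ?_
    rw [mul_assoc]
    gcongr
    exact hc.sqrt_sqNorm_le hφ hΦ (hlt z (hsupport hz)) w
  obtain ⟨z, -, hz, rfl⟩ := exists_pos_of_edist_lt (hasCompactSupport_radialBump hT)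
    (fun z hz => hc.mem_rescaledEnd_source hφ hΦ (hlt z (hsupport hz)))
    (contDiff_radialBump.of_le (by simp)) (by positivity) hbound
    (hc.mem_rescaledEnd_source hφ hΦ (hlt 0 (by rw [sqNorm_zero]; positivity)))
    (hD.trans_le hzero) hx
  exact ⟨z, sqNorm_lt_of_radialBump_pos hT hz, rfl⟩

end IsGoodCenter

end Distance

end EndDistance

section Clusters

local notation "ℝ^" n:max => EuclideanSpace ℝ (Fin n)

variable {n : ℕ} {N : Type*} [TopologicalSpace N] {φ : OpenPartialHomeomorph N (ℝ^n)} {θ : ℝ → ℝ}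
  {K : Set (ℝ^n)} {T S : ℝ} {C : Set (ℝ^n × ℝ)} {c : ℝ^n × ℝ} {p q : N × ℝ}

theorem sqNorm_add_le {V : Type*} [NormedAddCommGroup V] [InnerProductSpace ℝ V] (z w : V × ℝ) :
    sqNorm (z + w) ≤ 2 * sqNorm z + 2 * sqNorm w := by
  have hpar := parallelogram_law_with_norm ℝ z.1 w.1
  simp only [sqNorm, Prod.fst_add, Prod.snd_add]
  nlinarith [sq_nonneg ‖z.1 - w.1‖, sq_nonneg (z.2 - w.2)]

theorem endBall_mono (hS : 0 ≤ S) (hST : S ≤ T) : endBall φ θ S c ⊆ endBall φ θ T c :=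
  fun _ hp => ⟨hp.1, hp.2.trans_le (pow_le_pow_left₀ hS hST 2)⟩

theorem isOpen_endBall : IsOpen (endBall φ θ T c) := by
  have hφ : ContinuousOn (fun p : N × ℝ => φ p.1) (Prod.fst ⁻¹' φ.source) :=
    φ.continuousOn.comp continuousOn_fst fun p hp => hp
  have hcoord : ContinuousOn (endCoord φ θ c) (Prod.fst ⁻¹' φ.source) :=
    ((hφ.sub continuousOn_const).const_smul (θ c.2)).prodMk
      (continuousOn_snd.sub continuousOn_const)
  exact (contDiff_sqNorm.continuous.comp_continuousOn hcoord).isOpen_inter_preimage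
    (φ.open_source.preimage continuous_fst) isOpen_Iio

/-- The sum of the bumps of radius `T` in the rescaled coordinates around the centers in `C`, where
a bump is zero outside the domain of its coordinates. -/
def clusterFun (φ : OpenPartialHomeomorph N (ℝ^n)) (θ : ℝ → ℝ) (T : ℝ) (C : Set (ℝ^n × ℝ))
    (p : N × ℝ) : ℝ :=
  ∑ᶠ c ∈ C, (endBall φ θ T c).indicator (radialBump T ∘ endCoord φ θ c) p

/-- A set of good centers around which the balls of radius `2 T` are disjoint, so that at most one
bump contributes to `clusterFun φ θ T C` near any given point. -/
structure IsCluster (φ : OpenPartialHomeomorph N (ℝ^n)) (θ : ℝ → ℝ) (K : Set (ℝ^n)) (T : ℝ)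
    (C : Set (ℝ^n × ℝ)) : Prop where
  isGoodCenter : ∀ c ∈ C, IsGoodCenter θ K T c
  pairwiseDisjoint : C.PairwiseDisjoint (endBall φ θ (2 * T))

theorem clusterFun_nonneg : 0 ≤ clusterFun φ θ T C p :=
  finsum_nonneg fun _ => finsum_nonneg fun _ => indicator_nonneg (fun _ _ => radialBump_nonneg) _

theorem clusterFun_eq_zero (hp : ∀ c ∈ C, p ∉ endBall φ θ T c) : clusterFun φ θ T C p = 0 :=
  finsum_mem_eq_zero_of_forall_eq_zero fun c hc => indicator_of_notMem (hp c hc) _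

namespace IsCluster

theorem clusterFun_eq (hC : IsCluster φ θ K T C) (hT : 0 < T) (hc : c ∈ C)
    (hp : p ∈ endBall φ θ (2 * T) c) :
    clusterFun φ θ T C p = radialBump T (endCoord φ θ c p) := by
  have hother (c' : ℝ^n × ℝ) (hc' : c' ≠ c) :
      C.indicator (fun c => (endBall φ θ T c).indicator (radialBump T ∘ endCoord φ θ c) p) c' =
        0 := by
    refine indicator_apply_eq_zero.2 fun hc'C => indicator_of_notMem (fun hpc' => ?_) _
    exact disjoint_left.1 (hC.pairwiseDisjoint hc'C hc hc')
      (endBall_mono hT.le (by linarith : T ≤ 2 * T) hpc') hp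
  rw [clusterFun, finsum_mem_def, finsum_eq_single _ c hother, indicator_of_mem hc]
  by_cases hpT : p ∈ endBall φ θ T c
  · exact indicator_of_mem hpT _
  · rw [indicator_of_notMem hpT, radialBump_eq_zero hT]
    exact not_lt.1 fun hlt => hpT ⟨hp.1, hlt⟩

theorem clusterFun_le (hC : IsCluster φ θ K T C) (hT : 0 < T) : clusterFun φ θ T C p ≤ 3 := by
  by_cases hp : ∃ c ∈ C, p ∈ endBall φ θ (2 * T) c
  · obtain ⟨c, hc, hpc⟩ := hp
    exact (hC.clusterFun_eq hT hc hpc).trans_le (radialBump_le hT _)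
  · rw [clusterFun_eq_zero fun c hc hpc =>
      hp ⟨c, hc, endBall_mono hT.le (by linarith : T ≤ 2 * T) hpc⟩]
    norm_num

theorem clusterFun_eventuallyEq (hC : IsCluster φ θ K T C) (hT : 0 < T) (hc : c ∈ C)
    (hp : p ∈ endBall φ θ (2 * T) c) :
    clusterFun φ θ T C =ᶠ[𝓝 p] radialBump T ∘ endCoord φ θ c := by
  filter_upwards [isOpen_endBall.mem_nhds hp] with q hq
  exact hC.clusterFun_eq hT hc hq

end IsCluster

theorem IsGoodCenter.mem_endBall_two_mul (hc : IsGoodCenter θ K T c) (hT : 0 < T)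
    (hq : q ∈ endBall φ θ T c) (hp : p.1 ∈ φ.source)
    (hpq : sqNorm ((2 * θ q.2) • (φ p.1 - φ q.1), p.2 - q.2) < T ^ 2) :
    p ∈ endBall φ θ (2 * T) c := by
  refine ⟨hp, ?_⟩
  have hθ : θ c.2 ≤ 2 * θ q.2 := by
    simpa [endCoord] using hc.two_mul_le (endCoord φ θ c q) (hq.2.trans_le (by gcongr; linarith))
  have hsum : endCoord φ θ c p =
      endCoord φ θ c q + (θ c.2 • (φ p.1 - φ q.1), p.2 - q.2) := by
    simp only [endCoord, Prod.mk_add_mk, ← smul_add, add_comm, sub_add_sub_cancel]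
  have hdiff : sqNorm (θ c.2 • (φ p.1 - φ q.1), p.2 - q.2) ≤
      sqNorm ((2 * θ q.2) • (φ p.1 - φ q.1), p.2 - q.2) := by
    simp only [sqNorm, norm_smul, Real.norm_of_nonneg hc.pos.le,
      Real.norm_of_nonneg (hc.pos.le.trans hθ)]
    have hθ_nonneg := hc.pos.le
    gcongr
  rw [hsum]
  refine (sqNorm_add_le _ _).trans_lt ?_
  nlinarith [hq.2]

section Gradient

variable [ChartedSpace (ℝ^n) N] [IsManifold (𝓡 n) ∞ N]
  [RiemannianBundle (fun y : N => TangentSpace (𝓡 n) y)] {κ : ℝ}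

theorem IsCluster.le_gradNorm_clusterFun (hC : IsCluster φ θ K T C) (hφ : IsAdaptedChart φ K κ)
    (hT : 0 < T) {ε : ℝ} (hε : 0 < ε)
    (hfar : ∀ c ∈ C, p ∈ endBall φ θ T c → ε ^ 2 ≤ sqNorm (endCoord φ θ c p))
    (hp : 1 ≤ clusterFun φ θ T C p) :
    ε / (T ^ 2 * √κ) ≤ gradNorm (warpedMetric n θ) (clusterFun φ θ T C) p := by
  obtain ⟨c, hc, hpc⟩ : ∃ c ∈ C, p ∈ endBall φ θ T c := by
    by_contra! hpC
    linarith [clusterFun_eq_zero hpC]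
  have hpc' := endBall_mono hT.le (by linarith : T ≤ 2 * T) hpc
  have hgood := hC.isGoodCenter c hc
  have hparam := endParam_endCoord hgood.ne_zero hpc.1
  rw [← hparam]
  refine hgood.le_gradNorm hφ hT hε (hfar c hc hpc) ((hC.clusterFun_eq hT hc hpc').symm ▸ hp) ?_
  rw [hparam]
  exact hC.clusterFun_eventuallyEq hT hc hpc'

end Gradient

variable [T2Space N] [ChartedSpace (ℝ^n) N] [RiemannianBundle (fun y : N => TangentSpace (𝓡 n) y)]
  {κ : ℝ}

theorem eventually_forall_mem_endBall_two_mul (hθ : IsSubconicScaling θ)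
    (hφ : IsAdaptedChart φ K κ) (hT : 0 < T) (hp : 1 < p.2) :
    ∀ᶠ q in 𝓝 p, ∀ c, IsGoodCenter θ K T c → q ∈ endBall φ θ T c → p ∈ endBall φ θ (2 * T) c := by
  by_cases hpφ : p.1 ∈ φ.source
  · have hφp : ContinuousAt (fun q : N × ℝ => φ q.1) p :=
      ContinuousAt.comp (f := Prod.fst) (φ.continuousAt hpφ) continuousAt_fst
    have hθp : ContinuousAt (fun q : N × ℝ => θ q.2) p :=
      ContinuousAt.comp (f := Prod.snd) (hθ.contDiffAt hp).continuousAt continuousAt_snd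
    have hclose : ContinuousAt
        (fun q : N × ℝ => sqNorm ((2 * θ q.2) • (φ p.1 - φ q.1), p.2 - q.2)) p :=
      contDiff_sqNorm.continuous.continuousAt.comp
        (((hθp.const_mul 2).smul (hφp.const_sub _)).prodMk (continuousAt_snd.const_sub _))
    filter_upwards [hclose.eventually_lt_const (u := T ^ 2) (by simpa [sqNorm] using pow_pos hT 2)]
      with q hq c hc hqc
    exact hc.mem_endBall_two_mul hT hqc hpφ hq
  · have hclosed : IsClosed (φ.symm '' K) :=
      (hφ.isCompact.image_of_continuousOn (φ.continuousOn_symm.mono hφ.subset_target)).isClosed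
    have hpK : p.1 ∉ φ.symm '' K := fun ⟨v, hv, hvp⟩ =>
      hpφ (hvp ▸ φ.map_target (hφ.subset_target hv))
    filter_upwards [continuousAt_fst.eventually (hclosed.isOpen_compl.mem_nhds hpK)]
      with q hq c hc hqc
    refine (hq ⟨_, hc.mem _ (hqc.2.trans_le (by gcongr; linarith)), ?_⟩).elim
    exact congrArg Prod.fst (endParam_endCoord hc.ne_zero hqc.1)

theorem IsCluster.clusterFun_eventuallyEq_zero (hC : IsCluster φ θ K T C)
    (hθ : IsSubconicScaling θ) (hφ : IsAdaptedChart φ K κ) (hT : 0 < T) (hp : 1 < p.2)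
    (hpC : ∀ c ∈ C, p ∉ endBall φ θ (2 * T) c) : clusterFun φ θ T C =ᶠ[𝓝 p] 0 := by
  filter_upwards [eventually_forall_mem_endBall_two_mul hθ hφ hT hp] with q hq
  exact clusterFun_eq_zero fun c hc hqc => hpC c hc (hq c (hC.isGoodCenter c hc) hqc)

theorem IsCluster.contMDiffAt_clusterFun (hC : IsCluster φ θ K T C) (hθ : IsSubconicScaling θ)
    (hφ : IsAdaptedChart φ K κ) (hT : 0 < T) (hp : 1 < p.2) :
    ContMDiffAt (endModel n) 𝓘(ℝ, ℝ) ∞ (clusterFun φ θ T C) p := by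
  by_cases hpC : ∃ c ∈ C, p ∈ endBall φ θ (2 * T) c
  · obtain ⟨c, hc, hpc⟩ := hpC
    refine ContMDiffAt.congr_of_eventuallyEq ?_ (hC.clusterFun_eventuallyEq hT hc hpc)
    exact (contDiff_radialBump.contMDiff _).comp p
      (contMDiffAt_endCoord hφ.mem_maximalAtlas hpc.1)
  · push Not at hpC
    exact contMDiffAt_const.congr_of_eventuallyEq
      (hC.clusterFun_eventuallyEq_zero hθ hφ hT hp hpC)

variable [IsManifold (𝓡 n) ∞ N]

theorem IsCluster.isCbInfty_clusterFun
    [IsContMDiffRiemannianBundle (𝓡 n) ∞ (ℝ^n) (fun y : N => TangentSpace (𝓡 n) y)]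
    (hC : IsCluster φ θ K T C) (hθ : IsSubconicScaling θ) (hφ : IsAdaptedChart φ K κ)
    (hT : 0 < T) :
    IsCbInfty (warpedMetric n θ) (endBasis n) (univ ×ˢ Ioi 1) (clusterFun φ θ T C) := by
  refine ⟨fun p hp => (hC.contMDiffAt_clusterFun hθ hφ hT hp.2).contMDiffWithinAt, fun j => ?_⟩
  have hparam (c : ℝ^n × ℝ) (hc : c ∈ C) (p : N × ℝ) (hp : p ∈ endBall φ θ (2 * T) c) :
      endParam φ θ c (endCoord φ θ c p) = p :=
    endParam_endCoord (hC.isGoodCenter c hc).ne_zero hp.1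
  obtain ⟨D, hD⟩ := exists_covNorm_rescaledChart_le
    (A := {a : (ℝ^n × ℝ) × (N × ℝ) // a.1 ∈ C ∧ a.2 ∈ endBall φ θ (2 * T) a.1})
    (c := fun a => a.1.1) (z := fun a => endCoord φ θ a.1.1 a.1.2)
    (fun a => hC.isGoodCenter _ a.2.1) hφ (fun a => a.2.2.2) hθ contDiff_radialBump
    (f := fun _ => clusterFun φ θ T C) (fun a => by
      rw [hparam _ a.2.1 _ a.2.2]
      exact hC.clusterFun_eventuallyEq hT a.2.1 a.2.2) j
  refine ⟨max D 0, fun p hp => ?_⟩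
  by_cases hpC : ∃ c ∈ C, p ∈ endBall φ θ (2 * T) c
  · obtain ⟨c, hc, hpc⟩ := hpC
    have hbound := hD ⟨(c, p), hc, hpc⟩
    rw [hparam c hc p hpc] at hbound
    refine ⟨rescaledChart φ θ c (hC.isGoodCenter c hc).ne_zero,
      rescaledChart_mem_maximalAtlas hφ.mem_maximalAtlas, ?_, le_max_of_le_left hbound⟩
    rw [rescaledChart_source]
    exact ⟨hpc.1, mem_univ _⟩
  · push Not at hpC
    have hzero := hC.clusterFun_eventuallyEq_zero hθ hφ hT hp.2 hpC
    have hmem := mem_chart_source (ModelProd (ℝ^n) ℝ) p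
    exact ⟨_, IsManifold.chart_mem_maximalAtlas p, hmem,
      (covNorm_eq_zero_of_eventuallyEq hmem hzero j).le.trans (le_max_right _ _)⟩

end Clusters

section Cells

local notation "ℝ^" n:max => EuclideanSpace ℝ (Fin n)

variable {n : ℕ} {θ : ℝ → ℝ} {K : Set (ℝ^n)} {T D : ℝ} {c c' : ℝ^n × ℝ} {q : ℕ}

/-- The index of the cell containing `c` in a grid of mesh about `1` for the metric
`dr² + θ(r)² |dv|²`. -/
def cellIndex (θ : ℝ → ℝ) (c : ℝ^n × ℝ) : ℤ × (Fin n → ℤ) :=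
  (⌊c.2⌋, fun i => ⌊θ ⌊c.2⌋ * c.1 i⌋)

/-- The residue modulo `q` of a cell index: the color of the cell, chosen so that distinct cells of
the same color are far apart. -/
def cellColor (q : ℕ) (k : ℤ × (Fin n → ℤ)) : ZMod q × (Fin n → ZMod q) :=
  (k.1, fun i => k.2 i)

theorem floor_eq_floor_of_intCast_eq {x y : ℝ} (hxy : |x - y| ≤ D) (hq : D + 1 ≤ q)
    (h : (⌊x⌋ : ZMod q) = ⌊y⌋) : ⌊x⌋ = ⌊y⌋ := by
  rw [ZMod.intCast_eq_intCast_iff, Int.modEq_iff_dvd] at h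
  have hlt : |((⌊y⌋ - ⌊x⌋ : ℤ) : ℝ)| < q := by
    rw [abs_le] at hxy
    push_cast
    rw [abs_lt]
    constructor <;> linarith [Int.floor_le x, Int.floor_le y, Int.lt_floor_add_one x,
      Int.lt_floor_add_one y]
  exact (sub_eq_zero.1 (Int.eq_zero_of_abs_lt_dvd h (by exact_mod_cast hlt))).symm

theorem norm_le_of_forall_abs_le {v : ℝ^n} (hv : ∀ i, |v i| ≤ 1) : ‖v‖ ≤ n := by
  calc ‖v‖ = ‖∑ i, v i • EuclideanSpace.single i (1 : ℝ)‖ := by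
        simpa using congrArg norm ((EuclideanSpace.basisFun (Fin n) ℝ).sum_repr v).symm
    _ ≤ ∑ i, ‖v i • EuclideanSpace.single i (1 : ℝ)‖ := norm_sum_le _ _
    _ ≤ ∑ _i : Fin n, 1 := Finset.sum_le_sum fun i _ => by simpa [norm_smul] using hv i
    _ = n := by simp

theorem dist_le_of_cellIndex_eq (h : cellIndex θ c = cellIndex θ c') (hθ : 0 ≤ θ ⌊c.2⌋) :
    |c.2 - c'.2| ≤ 1 ∧ θ ⌊c.2⌋ * dist c.1 c'.1 ≤ n := by
  obtain ⟨hfloor, hcoord⟩ := Prod.mk.inj h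
  refine ⟨(Int.abs_sub_lt_one_of_floor_eq_floor hfloor).le, ?_⟩
  rw [← hfloor] at hcoord
  have hle : ‖θ ⌊c.2⌋ • (c.1 - c'.1)‖ ≤ n := norm_le_of_forall_abs_le fun i => by
    have hi := (Int.abs_sub_lt_one_of_floor_eq_floor (congrFun hcoord i)).le
    rwa [← mul_sub] at hi
  rwa [norm_smul, Real.norm_of_nonneg hθ, ← dist_eq_norm] at hle

theorem IsGoodCenter.of_abs_sub_lt (hc : IsGoodCenter θ K T c) {r : ℝ} (hr : |r - c.2| < 2 * T) :
    θ r ≤ 2 * θ c.2 ∧ θ c.2 ≤ 2 * θ r := by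
  have hz : sqNorm ((0, r - c.2) : ℝ^n × ℝ) < (2 * T) ^ 2 := by
    simpa [sqNorm] using pow_lt_pow_left₀ hr (abs_nonneg _) two_ne_zero
  simpa using And.intro (hc.le_two_mul _ hz) (hc.two_mul_le _ hz)

theorem IsGoodCenter.of_floor (hc : IsGoodCenter θ K T c) (hT : 1 ≤ T) :
    0 < θ ⌊c.2⌋ ∧ θ ⌊c.2⌋ ≤ 2 * θ c.2 ∧ θ c.2 ≤ 2 * θ ⌊c.2⌋ := by
  obtain ⟨hle, hge⟩ := hc.of_abs_sub_lt (r := ⌊c.2⌋) <| by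
    rw [abs_lt]
    constructor <;> linarith [Int.floor_le c.2, Int.lt_floor_add_one c.2]
  exact ⟨by linarith [hc.one_le], hle, hge⟩

section EndBall

variable {N : Type*} [TopologicalSpace N] {φ : OpenPartialHomeomorph N (ℝ^n)} {p : N × ℝ}

theorem abs_snd_lt_of_mem_endBall (hD : 0 ≤ D) (hp : p ∈ endBall φ θ D c) : |p.2 - c.2| < D :=
  abs_lt_of_sq_lt_sq ((le_add_of_nonneg_left (sq_nonneg _)).trans_lt hp.2) hD

theorem mul_dist_lt_of_mem_endBall (hD : 0 ≤ D) (hc : 0 ≤ θ c.2) (hp : p ∈ endBall φ θ D c) :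
    θ c.2 * dist (φ p.1) c.1 < D := by
  have hlt := lt_of_pow_lt_pow_left₀ 2 hD ((le_add_of_nonneg_right (sq_nonneg _)).trans_lt hp.2)
  rwa [endCoord, norm_smul, Real.norm_of_nonneg hc, ← dist_eq_norm] at hlt

theorem IsGoodCenter.mem_endBall_of_sqNorm_lt
    (hp : IsGoodCenter θ K T (φ p.1, p.2)) (hpφ : p.1 ∈ φ.source) (hT : 0 < T) {z : ℝ^n × ℝ}
    (hz : sqNorm z < T ^ 2) : p ∈ endBall φ θ (2 * T) ((θ p.2)⁻¹ • z.1 + φ p.1, z.2 + p.2) := by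
  refine ⟨hpφ, ?_⟩
  have hslow : θ (z.2 + p.2) ≤ 2 * θ p.2 :=
    hp.le_two_mul z (hz.trans_le (by gcongr; linarith))
  have hge : θ p.2 ≤ 2 * θ (z.2 + p.2) := hp.two_mul_le z (hz.trans_le (by gcongr; linarith))
  have hpos : 0 < θ p.2 := hp.pos
  have hratio : (θ (z.2 + p.2) * (θ p.2)⁻¹) ^ 2 ≤ 2 ^ 2 := by
    refine pow_le_pow_left₀ (mul_nonneg (by linarith) (by positivity)) ?_ 2
    rwa [← div_eq_mul_inv, div_le_iff₀ hpos]
  calc sqNorm (endCoord φ θ ((θ p.2)⁻¹ • z.1 + φ p.1, z.2 + p.2) p)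
      = (θ (z.2 + p.2) * (θ p.2)⁻¹) ^ 2 * ‖z.1‖ ^ 2 + z.2 ^ 2 := by
        simp only [endCoord, sub_add_cancel_right, smul_neg, smul_smul, sqNorm, norm_neg,
          norm_smul, Real.norm_eq_abs, mul_pow, sq_abs, neg_sq]
    _ ≤ 2 ^ 2 * ‖z.1‖ ^ 2 + 2 ^ 2 * z.2 ^ 2 := by
        gcongr
        linarith [sq_nonneg z.2]
    _ = 2 ^ 2 * sqNorm z := by rw [sqNorm, mul_add]
    _ < (2 * T) ^ 2 := by
        rw [mul_pow]
        gcongr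

theorem cellIndex_eq_of_mem_endBall (hT : 1 ≤ T) (hc : IsGoodCenter θ K T c)
    (hc' : IsGoodCenter θ K T c') (hp : p ∈ endBall φ θ (2 * T) c)
    (hp' : p ∈ endBall φ θ (2 * T) c') (hq : 8 * T + 1 ≤ q)
    (h : cellColor q (cellIndex θ c) = cellColor q (cellIndex θ c')) :
    cellIndex θ c = cellIndex θ c' := by
  have hT' : 0 ≤ 2 * T := by linarith
  obtain ⟨hcolor, hcolors⟩ := Prod.mk.inj h
  have hfloor : ⌊c.2⌋ = ⌊c'.2⌋ := by
    refine floor_eq_floor_of_intCast_eq (D := 4 * T) ?_ (by linarith) hcolor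
    have hheight := abs_lt.1 (abs_snd_lt_of_mem_endBall hT' hp)
    have hheight' := abs_lt.1 (abs_snd_lt_of_mem_endBall hT' hp')
    rw [abs_le]
    constructor <;> linarith
  refine Prod.ext hfloor (funext fun i =>
    floor_eq_floor_of_intCast_eq (D := 8 * T) ?_ hq (congrFun hcolors i))
  obtain ⟨hpos, hle, -⟩ := hc.of_floor hT
  obtain ⟨-, hle', -⟩ := hc'.of_floor hT
  rw [← hfloor] at hle' ⊢
  have hdist := mul_dist_lt_of_mem_endBall hT' hc.pos.le hp
  have hdist' := mul_dist_lt_of_mem_endBall hT' hc'.pos.le hp'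
  calc |θ ⌊c.2⌋ * c.1 i - θ ⌊c.2⌋ * c'.1 i|
      = θ ⌊c.2⌋ * |(c.1 - c'.1) i| := by
        rw [← mul_sub, abs_mul, abs_of_pos hpos, PiLp.sub_apply]
    _ ≤ θ ⌊c.2⌋ * dist c.1 c'.1 := by
        rw [dist_eq_norm]
        exact mul_le_mul_of_nonneg_left (PiLp.norm_apply_le (c.1 - c'.1) i) hpos.le
    _ ≤ θ ⌊c.2⌋ * dist (φ p.1) c.1 + θ ⌊c.2⌋ * dist (φ p.1) c'.1 := by
        rw [← mul_add]
        exact mul_le_mul_of_nonneg_left (dist_triangle_left _ _ _) hpos.le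
    _ ≤ 2 * θ c.2 * dist (φ p.1) c.1 + 2 * θ c'.2 * dist (φ p.1) c'.1 := by gcongr
    _ ≤ 8 * T := by linarith

theorem sqNorm_endCoord_le_of_cellIndex_eq (hD : 0 ≤ D) (hT : 4 * (3 * D + 2 * n + 1) ≤ T)
    (hc : IsGoodCenter θ K T c) (hc' : IsGoodCenter θ K T c')
    (h : cellIndex θ c' = cellIndex θ c) (hp : p ∈ endBall φ θ D c') :
    sqNorm (endCoord φ θ c p) ≤ (T / 4) ^ 2 := by
  have hT' : 1 ≤ T := by linarith [(Nat.cast_nonneg n : (0 : ℝ) ≤ n)]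
  obtain ⟨hpos, -, -⟩ := hc'.of_floor hT'
  obtain ⟨hheight, hcell⟩ := dist_le_of_cellIndex_eq h hpos.le
  obtain ⟨-, -, hfloor⟩ := hc.of_floor hT'
  have hfloor_eq : ⌊c'.2⌋ = ⌊c.2⌋ := congrArg Prod.fst h
  rw [← hfloor_eq] at hfloor
  obtain ⟨hslow, -⟩ := hc'.of_abs_sub_lt (r := c.2) (by rw [abs_sub_comm]; linarith)
  have hp₂ := (abs_snd_lt_of_mem_endBall hD hp).le
  have hp₁ := (mul_dist_lt_of_mem_endBall hD hc'.pos.le hp).le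
  have hsnd : |p.2 - c.2| ≤ D + 1 := (abs_sub_le _ c'.2 _).trans (add_le_add hp₂ hheight)
  have hfst : θ c.2 * dist (φ p.1) c.1 ≤ 2 * D + 2 * n :=
    calc θ c.2 * dist (φ p.1) c.1
        ≤ θ c.2 * dist (φ p.1) c'.1 + θ c.2 * dist c'.1 c.1 := by
          rw [← mul_add]
          exact mul_le_mul_of_nonneg_left (dist_triangle _ _ _) hc.pos.le
      _ ≤ 2 * θ c'.2 * dist (φ p.1) c'.1 + 2 * θ ⌊c'.2⌋ * dist c'.1 c.1 := by gcongr
      _ ≤ 2 * D + 2 * n := by linarith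
  calc sqNorm (endCoord φ θ c p)
      = (θ c.2 * dist (φ p.1) c.1) ^ 2 + |p.2 - c.2| ^ 2 := by
        rw [sqNorm, endCoord, norm_smul, Real.norm_of_nonneg hc.pos.le, ← dist_eq_norm, sq_abs]
    _ ≤ (2 * D + 2 * n) ^ 2 + (D + 1) ^ 2 := by
        gcongr
        exact mul_nonneg hc.pos.le dist_nonneg
    _ ≤ (2 * D + 2 * n + (D + 1)) ^ 2 := by
        have : 0 ≤ (2 * D + 2 * n) * (D + 1) := by positivity
        linarith [add_sq (2 * D + 2 * n) (D + 1)]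
    _ ≤ (T / 4) ^ 2 := by
        gcongr
        linarith

theorem exists_finite_isCluster (hD : 0 ≤ D) (hT : 4 * (3 * D + 2 * n + 1) ≤ T)
    {Z : Set (ℝ^n × ℝ)} (hZ : ∀ c ∈ Z, IsGoodCenter θ K T c) :
    ∃ 𝒞 : Set (Set (ℝ^n × ℝ)), 𝒞.Finite ∧ (∀ C ∈ 𝒞, C ⊆ Z ∧ IsCluster φ θ K T C) ∧
      ∀ c' ∈ Z, ∀ p ∈ endBall φ θ D c', ∃ C ∈ 𝒞, ∃ c ∈ C,
        sqNorm (endCoord φ θ c p) ≤ (T / 4) ^ 2 := by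
  have hT' : 1 ≤ T := by linarith [(Nat.cast_nonneg n : (0 : ℝ) ≤ n)]
  obtain ⟨q, hq⟩ := exists_nat_ge (8 * T + 1)
  have : NeZero q := ⟨fun h => by
    rw [h, Nat.cast_zero] at hq
    linarith⟩
  obtain ⟨Y, hYZ, hY⟩ := exists_subset_bijOn Z (cellIndex θ)
  refine ⟨range fun color => {c ∈ Y | cellColor q (cellIndex θ c) = color}, finite_range _,
    ?_, fun c' hc' p hp => ?_⟩
  · rintro _ ⟨color, rfl⟩
    refine ⟨fun c hc => hYZ hc.1, fun c hc => hZ c (hYZ hc.1), fun c hc c' hc' hne => ?_⟩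
    refine disjoint_left.2 fun p hp hp' => hne (hY.injOn hc.1 hc'.1 ?_)
    exact cellIndex_eq_of_mem_endBall hT' (hZ c (hYZ hc.1)) (hZ c' (hYZ hc'.1)) hp hp' hq
      (hc.2.trans hc'.2.symm)
  · obtain ⟨c, hc, hcell⟩ := hY.surjOn ⟨c', hc', rfl⟩
    exact ⟨_, ⟨cellColor q (cellIndex θ c), rfl⟩, c, ⟨hc, rfl⟩,
      sqNorm_endCoord_le_of_cellIndex_eq hD hT (hZ c (hYZ hc)) (hZ c' hc') hcell.symm hp⟩

end EndBall

end Cells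

section ControlFunctions

local notation "ℝ^" n:max => EuclideanSpace ℝ (Fin n)

variable {n : ℕ} {N : Type*} [TopologicalSpace N] [ChartedSpace (ℝ^n) N] [IsManifold (𝓡 n) ∞ N]
  [RiemannianBundle (fun y : N => TangentSpace (𝓡 n) y)]
  {θ : ℝ → ℝ} {Ω : Set (N × ℝ)} {R R' ρ ρ' : ℝ} {ψ : N × ℝ → ℝ} {U V : Set N}

/-- A function of class `C_b^∞` on `N × (R, ∞)` with values in `[0, 3]` whose gradient has norm at
least `2 ρ` wherever the function is at least `1`, except possibly in `Ω`. -/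
structure IsControlFunction (n : ℕ) {N : Type*} [TopologicalSpace N] [ChartedSpace (ℝ^n) N]
    [IsManifold (𝓡 n) ∞ N] [RiemannianBundle (fun y : N => TangentSpace (𝓡 n) y)]
    (θ : ℝ → ℝ) (Ω : Set (N × ℝ)) (R ρ : ℝ) (ψ : N × ℝ → ℝ) : Prop where
  isCbInfty : IsCbInfty (warpedMetric n θ) (endBasis n) (univ ×ˢ Ioi R) ψ
  nonneg : ∀ x, 0 ≤ ψ x
  le_three : ∀ x, ψ x ≤ 3
  le_gradNorm : ∀ x ∉ Ω, 1 ≤ ψ x → 2 * ρ ≤ gradNorm (warpedMetric n θ) ψ x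

theorem isControlFunction_zero : IsControlFunction n θ Ω R ρ fun _ => 0 where
  isCbInfty := isCbInfty_zero
  nonneg _ := le_rfl
  le_three _ := by norm_num
  le_gradNorm _ _ h := absurd h (by norm_num)

theorem IsControlFunction.mono (hψ : IsControlFunction n θ Ω R ρ ψ) (hR : R ≤ R') (hρ : ρ' ≤ ρ) :
    IsControlFunction n θ Ω R' ρ' ψ where
  isCbInfty := hψ.isCbInfty.mono (prod_mono_right (Ioi_subset_Ioi hR))
  nonneg := hψ.nonneg
  le_three := hψ.le_three
  le_gradNorm x hx h := (by linarith : 2 * ρ' ≤ 2 * ρ).trans (hψ.le_gradNorm x hx h)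

/-- Far out on the end, every point over `U` has a function `ψ ≥ 2` from a fixed finite set of
control functions. -/
def HasControlFunctions (n : ℕ) {N : Type*} [TopologicalSpace N] [ChartedSpace (ℝ^n) N]
    [IsManifold (𝓡 n) ∞ N] [RiemannianBundle (fun y : N => TangentSpace (𝓡 n) y)]
    (θ : ℝ → ℝ) (Ω : Set (N × ℝ)) (U : Set N) : Prop :=
  ∃ R : ℝ, 1 ≤ R ∧ ∃ ρ : ℝ, 0 < ρ ∧ ∃ F : Set (N × ℝ → ℝ), F.Finite ∧
    (∀ ψ ∈ F, IsControlFunction n θ Ω R ρ ψ) ∧ ∀ x ∈ U ×ˢ Ioi R, ∃ ψ ∈ F, 2 ≤ ψ x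

namespace HasControlFunctions

theorem empty : HasControlFunctions n θ Ω ∅ :=
  ⟨1, le_rfl, 1, one_pos, ∅, finite_empty, by simp, by simp⟩

theorem mono (hV : HasControlFunctions n θ Ω V) (hUV : U ⊆ V) : HasControlFunctions n θ Ω U := by
  obtain ⟨R, hR, ρ, hρ, F, hF, hcontrol, hcover⟩ := hV
  exact ⟨R, hR, ρ, hρ, F, hF, hcontrol, fun x hx => hcover x (prod_mono_left hUV hx)⟩

theorem union (hU : HasControlFunctions n θ Ω U) (hV : HasControlFunctions n θ Ω V) :
    HasControlFunctions n θ Ω (U ∪ V) := by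
  obtain ⟨R, hR, ρ, hρ, F, hF, hcontrol, hcover⟩ := hU
  obtain ⟨R', -, ρ', hρ', F', hF', hcontrol', hcover'⟩ := hV
  refine ⟨max R R', le_max_of_le_left hR, min ρ ρ', lt_min hρ hρ', F ∪ F', hF.union hF', ?_, ?_⟩
  · rintro ψ (hψ | hψ)
    · exact (hcontrol ψ hψ).mono (le_max_left _ _) (min_le_left _ _)
    · exact (hcontrol' ψ hψ).mono (le_max_right _ _) (min_le_right _ _)
  · rintro x ⟨hx | hx, hxR⟩
    · exact (hcover x ⟨hx, (le_max_left R R').trans_lt hxR⟩).imp fun _ h => ⟨.inl h.1, h.2⟩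
    · exact (hcover' x ⟨hx, (le_max_right R R').trans_lt hxR⟩).imp fun _ h => ⟨.inr h.1, h.2⟩

theorem exists_fin (h : HasControlFunctions n θ Ω univ) :
    ∃ R : ℝ, 1 ≤ R ∧ ∃ m : ℕ, 1 ≤ m ∧ ∃ ψ : Fin m → N × ℝ → ℝ, ∃ ρ : ℝ, 0 < ρ ∧
      (∀ k, IsControlFunction n θ Ω R ρ (ψ k)) ∧
      ∀ x ∈ (univ : Set N) ×ˢ Ioi R, ∃ l, 2 ≤ ψ l x := by
  obtain ⟨R, hR, ρ, hρ, F, hF, hcontrol, hcover⟩ := h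
  obtain ⟨m, ψ, -, hψ⟩ := (hF.insert fun _ => 0).fin_param
  refine ⟨R, hR, m, ?_, ψ, ρ, hρ, fun k => ?_, fun x hx => ?_⟩
  · obtain ⟨k, -⟩ : (fun _ => 0) ∈ range ψ := hψ ▸ mem_insert _ _
    exact k.pos
  · obtain hk | hk : ψ k ∈ insert (fun _ => 0) F := hψ ▸ mem_range_self k
    · exact hk ▸ isControlFunction_zero
    · exact hcontrol _ hk
  · obtain ⟨χ, hχ, hle⟩ := hcover x hx
    obtain ⟨l, rfl⟩ : χ ∈ range ψ := hψ ▸ mem_insert_of_mem _ hχ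
    exact ⟨l, hle⟩

end HasControlFunctions

section Cluster

variable {φ : OpenPartialHomeomorph N (ℝ^n)} {K : Set (ℝ^n)} {T κ : ℝ} {c : ℝ^n × ℝ}

theorem IsCluster.isControlFunction [T2Space N]
    [IsContMDiffRiemannianBundle (𝓡 n) ∞ (ℝ^n) (fun y : N => TangentSpace (𝓡 n) y)]
    {C : Set (ℝ^n × ℝ)} (hC : IsCluster φ θ K T C) (hθ : IsSubconicScaling θ)
    (hφ : IsAdaptedChart φ K κ) (hT : 0 < T) {ε : ℝ} (hε : 0 < ε)
    (hΩ : ∀ c ∈ C, ∀ p ∈ endBall φ θ T c, sqNorm (endCoord φ θ c p) < ε ^ 2 → p ∈ Ω) :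
    IsControlFunction n θ Ω 1 (ε / (T ^ 2 * √κ) / 2) (clusterFun φ θ T C) where
  isCbInfty := hC.isCbInfty_clusterFun hθ hφ hT
  nonneg _ := clusterFun_nonneg
  le_three _ := hC.clusterFun_le hT
  le_gradNorm p hp hle := by
    rw [mul_div_cancel₀ _ two_ne_zero]
    exact hC.le_gradNorm_clusterFun hφ hT hε
      (fun c hc hpc => not_lt.1 fun hlt => hp (hΩ c hc p hpc hlt)) hle

end Cluster

section Network

variable {E : Type*} [NormedAddCommGroup E] [NormedSpace ℝ E]
  {H : Type*} [TopologicalSpace H] {I : ModelWithCorners ℝ E H}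
  {M : Type*} [EMetricSpace M] [ChartedSpace H M]
  [RiemannianBundle (fun x : M => TangentSpace I x)] [IsRiemannianManifold I M]
  {Φ : PartialDiffeomorph (endModel n) I (N × ℝ) M 1} {α α' : ℝ}
  {a : M → ℝ} {L η β : ℝ} {P : Set M}
  {φ : OpenPartialHomeomorph N (ℝ^n)} {K : Set (ℝ^n)} {T κ : ℝ} {c : ℝ^n × ℝ}

theorem NetworkControl.mem_controlRegion (hP : NetworkControl a L η β P)
    (hΦ : IsComparableEnd θ Φ α α') (hc : IsGoodCenter θ K T c) (hφ : IsAdaptedChart φ K κ)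
    (hT : 0 < T) (hcP : Φ (endParam φ θ c 0) ∈ P) {p : N × ℝ} (hp : p ∈ endBall φ θ T c)
    (hpη : sqNorm (endCoord φ θ c p) < (η / (2 * √(α' * κ))) ^ 2) :
    Φ p ∈ controlRegion a (2 * β) := by
  have hη := hP.η_pos
  have hακ : 0 < α' * κ := mul_pos hΦ.pos' (one_pos.trans_le hφ.one_le)
  refine hP.ball_subset _ hcP _ ?_
  have hdist := hc.edist_le hφ hΦ (hp.2.trans_le (by gcongr; linarith))
  rw [endParam_endCoord hc.ne_zero hp.1, edist_comm] at hdist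
  refine hdist.trans_lt ((ENNReal.ofReal_lt_ofReal_iff hη).2 ((Real.sqrt_lt' hη).2 ?_))
  rw [div_pow, mul_pow, Real.sq_sqrt hακ.le, lt_div_iff₀ (by positivity)] at hpη
  linarith

theorem NetworkControl.exists_forall_mem_endBall (hP : NetworkControl a L η β P)
    (hΦ : IsComparableEnd θ Φ α α') (hφ : IsAdaptedChart φ K κ) :
    ∃ D : ℝ, 0 < D ∧ ∀ p : N × ℝ, p.1 ∈ φ.source → ∀ K' ⊆ K, IsGoodCenter θ K' D (φ p.1, p.2) →
      ∃ c, c.1 ∈ K' ∧ Φ (endParam φ θ c 0) ∈ P ∧ p ∈ endBall φ θ (2 * D) c := by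
  have hκ := hφ.one_le
  have hα := hΦ.pos
  have hL := hP.L_pos
  obtain ⟨B, hB, hbump⟩ := exists_abs_fderiv_radialBump_le (V := ℝ^n)
  -- At this scale the gradient of a bump is so small that its support contains a ball of radius
  -- `L + 1` in `M`.
  let D := B * √(4 * κ / α) * (L + 1)
  have hD : 0 < D := by positivity
  have hreach : B / D * √(4 * κ / α) * (L + 1) < 2 := by
    rw [div_mul_eq_mul_div, div_mul_eq_mul_div, div_self hD.ne']
    exact one_lt_two
  refine ⟨D, hD, fun p hp K' hK hpD => ?_⟩
  have hlt : Metric.infEDist (Φ (endParam φ θ (φ p.1, p.2) 0)) P < ENNReal.ofReal (L + 1) :=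
    (hP.dist_le _).trans_lt ((ENNReal.ofReal_lt_ofReal_iff (by linarith)).2 (lt_add_one L))
  obtain ⟨x, hxP, hx⟩ := Metric.infEDist_lt_iff.1 hlt
  obtain ⟨z, hz, rfl⟩ := (hpD.mono hK hD.le le_rfl).exists_eq_endParam_of_edist_lt hφ hΦ hD hB.le
    (hbump D hD) hreach hx
  refine ⟨((θ p.2)⁻¹ • z.1 + φ p.1, z.2 + p.2), hpD.mem z (hz.trans (by gcongr; linarith)), ?_,
    hpD.mem_endBall_of_sqNorm_lt hp hD hz⟩
  simpa [endParam] using hxP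

variable [T2Space N] [IsContMDiffRiemannianBundle (𝓡 n) ∞ (ℝ^n) (fun y : N => TangentSpace (𝓡 n) y)]

theorem hasControlFunctions_of_isAdaptedChart (hθ : IsSubconicScaling θ)
    (hΦ : IsComparableEnd θ Φ α α') (hP : NetworkControl a L η β P) (hφ : IsAdaptedChart φ K κ)
    {δ : ℝ} (hδ : 0 < δ) :
    HasControlFunctions n θ (Φ ⁻¹' controlRegion a (2 * β))
      {y | y ∈ φ.source ∧ Metric.closedBall (φ y) (2 * δ) ⊆ K} := by
  have hκ := hφ.one_le
  have hα' := hΦ.pos'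
  have hη := hP.η_pos
  obtain ⟨D, hD, hnet⟩ := hP.exists_forall_mem_endBall hΦ hφ
  let T := 4 * (3 * (2 * D) + 2 * n + 1)
  have hDT : D ≤ T := by simp only [T]; linarith [(Nat.cast_nonneg n : (0 : ℝ) ≤ n)]
  have hT : 0 < T := hD.trans_le hDT
  obtain ⟨R, hR, hgood⟩ := exists_isGoodCenter (n := n) hθ hT hδ
  let Z := {c : ℝ^n × ℝ | Metric.closedBall c.1 δ ⊆ K ∧ R ≤ c.2 ∧ Φ (endParam φ θ c 0) ∈ P}
  have hZ (c : ℝ^n × ℝ) (hc : c ∈ Z) : IsGoodCenter θ K T c := hgood c K hc.2.1 hc.1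
  obtain ⟨𝒞, h𝒞, hcluster, hrepr⟩ := exists_finite_isCluster (φ := φ) (by positivity) le_rfl hZ
  let ε := η / (2 * √(α' * κ))
  have hε : 0 < ε := by positivity
  refine ⟨R + 2 * D, by linarith, ε / (T ^ 2 * √κ) / 2, by positivity,
    clusterFun φ θ T '' 𝒞, h𝒞.image _, ?_, fun p hp => ?_⟩
  · rintro _ ⟨C, hC, rfl⟩
    obtain ⟨hCZ, hC⟩ := hcluster C hC
    refine (hC.isControlFunction hθ hφ hT hε fun c hc p hp hpε => ?_).mono (by linarith) le_rfl
    exact hP.mem_controlRegion hΦ (hZ c (hCZ hc)) hφ hT (hCZ hc).2.2 hp hpε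
  · obtain ⟨⟨hpφ, hpK⟩, hpR : R + 2 * D < p.2⟩ := hp
    have hpT := hgood (φ p.1, p.2) _ (by linarith) subset_rfl
    obtain ⟨c', hc'δ, hc'P, hpc'⟩ := hnet p hpφ _
      ((Metric.closedBall_subset_closedBall (by linarith)).trans hpK)
      (hpT.mono subset_rfl hD.le hDT)
    have hc'K : Metric.closedBall c'.1 δ ⊆ K :=
      (Metric.closedBall_subset_closedBall' (by linarith [Metric.mem_closedBall.1 hc'δ])).trans hpK
    have hheight := (abs_lt.1 (abs_snd_lt_of_mem_endBall (by positivity) hpc')).2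
    obtain ⟨C, hC, c, hc, hpc⟩ := hrepr c' ⟨hc'K, by linarith, hc'P⟩ p hpc'
    refine ⟨_, ⟨C, hC, rfl⟩, ?_⟩
    rw [(hcluster C hC).2.clusterFun_eq hT hc ⟨hpφ, hpc.trans_lt (by gcongr; linarith)⟩]
    exact two_le_radialBump hT hpc

end Network

end ControlFunctions

section Main

local notation "ℝ^" n:max => EuclideanSpace ℝ (Fin n)

variable {n : ℕ} {N : Type*} [TopologicalSpace N] [T2Space N] [ChartedSpace (ℝ^n) N]
  [IsManifold (𝓡 n) ∞ N] [RiemannianBundle (fun y : N => TangentSpace (𝓡 n) y)]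
  [IsContMDiffRiemannianBundle (𝓡 n) ∞ (ℝ^n) (fun y : N => TangentSpace (𝓡 n) y)]
  {θ : ℝ → ℝ} {E : Type*} [NormedAddCommGroup E] [NormedSpace ℝ E]
  {H : Type*} [TopologicalSpace H] {I : ModelWithCorners ℝ E H}
  {M : Type*} [EMetricSpace M] [ChartedSpace H M]
  [RiemannianBundle (fun x : M => TangentSpace I x)] [IsRiemannianManifold I M]
  {Φ : PartialDiffeomorph (endModel n) I (N × ℝ) M 1} {α α' : ℝ}
  {a : M → ℝ} {L η β : ℝ} {P : Set M}

theorem exists_mem_nhds_hasControlFunctions (hθ : IsSubconicScaling θ)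
    (hΦ : IsComparableEnd θ Φ α α') (hP : NetworkControl a L η β P) (y : N) :
    ∃ U ∈ 𝓝 y, HasControlFunctions n θ (Φ ⁻¹' controlRegion a (2 * β)) U := by
  let φ := chartAt (ℝ^n) y
  obtain ⟨δ, hδ, hball⟩ := Metric.nhds_basis_closedBall.mem_iff.1
    (φ.open_target.mem_nhds (mem_chart_target (ℝ^n) y))
  obtain ⟨κ, hφ⟩ := exists_isAdaptedChart (IsManifold.chart_mem_maximalAtlas (I := 𝓡 n) y)
    (isCompact_closedBall _ _) hball
  refine ⟨_, ?_, hasControlFunctions_of_isAdaptedChart hθ hΦ hP hφ (by positivity : 0 < δ / 4)⟩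
  filter_upwards [chart_source_mem_nhds (ℝ^n) y,
    (φ.continuousAt (mem_chart_source (ℝ^n) y)).preimage_mem_nhds
      (Metric.ball_mem_nhds _ (half_pos hδ))] with y' hy' hy'δ
  exact ⟨hy', Metric.closedBall_subset_closedBall' (by linarith [Metric.mem_ball.1 hy'δ])⟩

theorem hasControlFunctions_univ [CompactSpace N] (hθ : IsSubconicScaling θ)
    (hΦ : IsComparableEnd θ Φ α α') (hP : NetworkControl a L η β P) :
    HasControlFunctions n θ (Φ ⁻¹' controlRegion a (2 * β)) univ :=
  isCompact_univ.induction_on .empty (fun _ _ hUV hV => hV.mono hUV) (fun _ _ => .union)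
    fun y _ => (nhdsWithin_univ y).symm ▸ exists_mem_nhds_hasControlFunctions hθ hΦ hP y

end Main

theorem lemma3p2_general {n : ℕ}
    {N : Type*} [TopologicalSpace N] [CompactSpace N] [T2Space N]
    [ChartedSpace (EuclideanSpace ℝ (Fin n)) N] [IsManifold (𝓡 n) ∞ N]
    [RiemannianBundle (fun y : N => TangentSpace (𝓡 n) y)]
    [IsContMDiffRiemannianBundle (𝓡 n) ∞ (EuclideanSpace ℝ (Fin n))
      (fun y : N => TangentSpace (𝓡 n) y)]
    (θ : ℝ → ℝ) (hθ : IsSubconicScaling θ)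
    {E : Type*} [NormedAddCommGroup E] [NormedSpace ℝ E]
    {H : Type*} [TopologicalSpace H] {I : ModelWithCorners ℝ E H}
    {M : Type*} [EMetricSpace M] [ChartedSpace H M]
    [RiemannianBundle (fun x : M => TangentSpace I x)] [IsRiemannianManifold I M]
    (Φ : PartialDiffeomorph (endModel n) I (N × ℝ) M 1) (hΦ : Φ.source = univ ×ˢ Ioi 1)
    (c C : ℝ) (hc : 0 < c)
    (hg : ∀ p ∈ Φ.source, ∀ v : TangentSpace (endModel n) p,
      c * warpedMetric n θ p v v ≤ ‖mfderiv (endModel n) I Φ p v‖ ^ 2 ∧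
      ‖mfderiv (endModel n) I Φ p v‖ ^ 2 ≤ C * warpedMetric n θ p v v)
    (a : M → ℝ) (L η β : ℝ) (P : Set M) (hP : NetworkControl a L η β P) :
    ∃ R : ℝ, 1 ≤ R ∧ ∃ m : ℕ, 1 ≤ m ∧ ∃ ψ : Fin m → N × ℝ → ℝ, ∃ ρ : ℝ, 0 < ρ ∧
      (∀ k, IsCbInfty (warpedMetric n θ) (endBasis n) (univ ×ˢ Ioi R) (ψ k)) ∧
      (∀ k, ∀ x ∈ (univ : Set N) ×ˢ Ioi R, 0 ≤ ψ k x ∧ ψ k x ≤ 3) ∧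
      (∀ k, ∀ x ∈ (univ : Set N) ×ˢ Ioi R, Φ x ∉ controlRegion a (2 * β) →
        gradNorm (warpedMetric n θ) (ψ k) x < 2 * ρ →
        ∃ l, 1 ≤ ψ l x ∧ 2 * ρ ≤ gradNorm (warpedMetric n θ) (ψ l) x ∧
          ψ k x + 1 / 2 ≤ ψ l x) := by
  have hend : IsComparableEnd θ Φ c (max C 1) :=
    ⟨hΦ, hc, lt_max_of_lt_right one_pos, fun p hp v => (hg p hp v).1, fun p hp v =>
      (hg p hp v).2.trans (mul_le_mul_of_nonneg_right (le_max_left C 1)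
        (warpedMetric_self_nonneg p v))⟩
  obtain ⟨R, hR, m, hm, ψ, ρ, hρ, hcontrol, hcover⟩ :=
    (hasControlFunctions_univ hθ hend hP).exists_fin
  refine ⟨R, hR, m, hm, ψ, ρ, hρ, fun k => (hcontrol k).isCbInfty,
    fun k x _ => ⟨(hcontrol k).nonneg x, (hcontrol k).le_three x⟩, fun k x hx hxΩ hgrad => ?_⟩
  obtain ⟨l, hl⟩ := hcover x hx
  have hk : ψ k x < 1 := not_le.1 fun h => hgrad.not_ge ((hcontrol k).le_gradNorm x hxΩ h)
  exact ⟨l, by linarith, (hcontrol l).le_gradNorm x hxΩ (by linarith), by linarith⟩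

end

theorem lemma3p2 {n : ℕ}
    -- the closed cross-section of the end, with its smooth Riemannian metric `h`
    {N : Type*} [TopologicalSpace N] [CompactSpace N] [T2Space N]
    [ChartedSpace (EuclideanSpace ℝ (Fin n)) N] [IsManifold (𝓡 n) ∞ N]
    [RiemannianBundle (fun y : N => TangentSpace (𝓡 n) y)]
    [IsContMDiffRiemannianBundle (𝓡 n) ∞ (EuclideanSpace ℝ (Fin n))
      (fun y : N => TangentSpace (𝓡 n) y)]
    -- the scaling function of the end
    (θ : ℝ → ℝ) (hθ : IsSubconicScaling θ)
    -- the ambient Riemannian manifold `(M, g)` with its Riemannian distance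
    {M : Type*} [EMetricSpace M]
    [ChartedSpace (EuclideanSpace ℝ (Fin (n + 1))) M] [IsManifold (𝓡 (n + 1)) ∞ M]
    [RiemannianBundle (fun x : M => TangentSpace (𝓡 (n + 1)) x)]
    [IsContMDiffRiemannianBundle (𝓡 (n + 1)) ∞ (EuclideanSpace ℝ (Fin (n + 1)))
      (fun x : M => TangentSpace (𝓡 (n + 1)) x)]
    [IsRiemannianManifold (𝓡 (n + 1)) M]
    -- the identification of `N × (1, ∞)` with an open subset of `M`, the end
    (Φ : PartialDiffeomorph (endModel n) (𝓡 (n + 1)) (N × ℝ) M ∞)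
    (hΦ : Φ.source = univ ×ˢ Ioi 1)
    -- on the end, `g` is uniformly comparable with `g₀ = dr² + θ(r)² h`
    (c C : ℝ) (hc : 0 < c)
    (hg : ∀ p ∈ Φ.source, ∀ v : TangentSpace (endModel n) p,
      c * warpedMetric n θ p v v ≤ ‖mfderiv (endModel n) (𝓡 (n + 1)) Φ p v‖ ^ 2 ∧
      ‖mfderiv (endModel n) (𝓡 (n + 1)) Φ p v‖ ^ 2 ≤ C * warpedMetric n θ p v v)
    -- the damping and the Network Control Condition on `(M, g)`
    (a : M → ℝ) (L η β : ℝ) (P : Set M) (hP : NetworkControl a L η β P) :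
    ∃ R : ℝ, 1 ≤ R ∧ ∃ m : ℕ, 1 ≤ m ∧ ∃ ψ : Fin m → N × ℝ → ℝ, ∃ ρ : ℝ, 0 < ρ ∧
      (∀ k, IsCbInfty (warpedMetric n θ) (endBasis n) (univ ×ˢ Ioi R) (ψ k)) ∧
      (∀ k, ∀ x ∈ (univ : Set N) ×ˢ Ioi R, 0 ≤ ψ k x ∧ ψ k x ≤ 3) ∧
      (∀ k, ∀ x ∈ (univ : Set N) ×ˢ Ioi R, Φ x ∉ controlRegion a (2 * β) →
        gradNorm (warpedMetric n θ) (ψ k) x < 2 * ρ →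
        ∃ l, 1 ≤ ψ l x ∧ 2 * ρ ≤ gradNorm (warpedMetric n θ) (ψ l) x ∧
          ψ k x + 1 / 2 ≤ ψ l x) :=
  lemma3p2_general θ hθ
    { Φ with
      contMDiffOn_toFun := Φ.contMDiffOn_toFun.of_le (by simp)
      contMDiffOn_invFun := Φ.contMDiffOn_invFun.of_le (by simp) }
    hΦ c C hc hg a L η β P hP
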